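/- Let $-\infty\le a<b\le\infty$, let $[a,b]$ denote the closed interval of $\mathbb R$ with these endpoints, let $N$ be fixed, and let $W:(a,b)\to\mathbb R^{N\times N}$ be a differentiable weight whose values are (symmetric) positive definite matrices, with finite moments $\int_a^b|x|^k W(x)\,dx$ for all $k\ge 0$. At every finite endpoint $c\in\{a,b\}$ assume $W(x)=|x-c|^{\gamma_c}\widetilde W(x)$, where $\gamma_c>-1$ and $\widetilde W$ has a non-zero limit at $c$. For a matrix-valued function $F$ of a complex variable put $F^*(z)=(F(\bar z))^*$. Let $\widehat P_n$ ($n\ge 0$) be the monic matrix polynomials with $\int_a^b \widehat P_n W\widehat P_m^*\,dx=0$ for $n\ne m$, let $\kappa_n$ be matrices such that the polynomials $\kappa_n\widehat P_n$ are orthonormal, i.e. $\int_a^b \kappa_n\widehat P_n W(\kappa_m\widehat P_m)^*\,dx=\delta_{nm}I_N$, and put $\gamma_n=\kappa_n^*\kappa_n$, with the convention $\widehat P_{-1}=0$, $\gamma_{-1}=0$. Fix $n\ge 0$ and let $Y^n:\mathbb C\setminus[a,b]\to\mathbb C^{2N\times 2N}$ be the solution of the following Riemann–Hilbert problem (blocks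 are $N\times N$): 1. $Y^n$ is analytic in $\mathbb C\setminus[a,b]$. 2. $Y^n$ has continuous boundary values $Y^n_\pm$ on $(a,b)$ from the upper ($+$) and lower ($-$) half plane, and $Y^n_+(x)=Y^n_-(x)\begin{pmatrix} I_N& W(x)\\ 0& I_N\end{pmatrix}$ for $x\in(a,b)$. 3. There are constant matrices $Y^n_i$ such that for every $m\in\mathbb N$, as $z\to\infty$ in $\mathbb C\setminus[a,b]$, $Y^n(z)=\Bigl(I_{2N}+\sum_{i=1}^m Y_i^n z^{-i}+O(z^{-m-1})\Bigr)\begin{pmatrix} z^nI_N&0\\0&z^{-n}I_N\end{pmatrix}$. 4. As $z\to c$, for each finite endpoint $c\in\{a,b\}$, the first block column of $Y^n$ is $O(1)$ and the second is $O(h(z))$, where $h(z)=|z-c|^{\gamma_c}$ if $\gamma_c<0$, $h(z)=\log|z-c|$ if $\gamma_c=0$, and $h(z)=1$ if $\gamma_c>0$. Define, for $z\in\mathbb C\setminus[a,b]$ and $k\ge -1$ (with $k\ge 0$ for $\mathfrak B_k$), $$\mathfrak A_k(z)=-\gamma_k\left(\int_a^b\frac{\widehat P_k(t)W'(t)\widehat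 P_k^*(t)}{t-z}\,dt-\frac{\widehat P_k(t)W(t)\widehat P_k^*(t)}{t-z}\bigg|_{t=a}^{t=b}\right),$$ $$\mathfrak B_k(z)=-\left(\int_a^b\frac{\widehat P_k(t)W'(t)\widehat P_{k-1}^*(t)}{t-z}\,dt-\frac{\widehat P_k(t)W(t)\widehat P_{k-1}^*(t)}{t-z}\bigg|_{t=a}^{t=b}\right)\gamma_{k-1},$$ where the values at $a$ and $b$ are limits from within $(a,b)$. If the integrals and the boundary values in $\mathfrak A_n(z)$, $\mathfrak A_{n-1}(z)$ and $\mathfrak B_n(z)$ all exist for $z\in\mathbb C\setminus[a,b]$, then $$\frac{d}{dz}Y^n(z)=\begin{pmatrix}-\mathfrak B_n(z)&-\frac1{2\pi i}\gamma_n^{-1}\mathfrak A_n(z)\\ 2\pi i\,\mathfrak A_{n-1}(z)\gamma_{n-1}&\mathfrak B_n^*(z)\end{pmatrix}Y^n(z),\qquad z\in\mathbb C\setminus[a,b].$$ Moreover, if the integral and the boundary values in $\mathfrak A_n(z)$ exist for $z\in\mathbb C\setminus[a,b]$, then $\gamma_n\mathfrak A_n^*(z)=\mathfrak A_n(z)\gamma_n$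 for $z\in\mathbb C\setminus[a,b]$. -/

import Mathlib

open Filter Topology MeasureTheory Matrix Polynomial

namespace MOPRL

/-- The open interval `(a, b)` of the real line; `a = ⊥` and `b = ⊤` are allowed. -/
def openInt (a b : EReal) : Set ℝ := {x | a < (x : EReal) ∧ (x : EReal) < b}

/-- The domain `ℂ \ [a, b]`, where `[a, b]` is the closed interval of the real line. -/
def offInt (a b : EReal) : Set ℂ :=
  {z | ¬ ∃ x : ℝ, a ≤ (x : EReal) ∧ (x : EReal) ≤ b ∧ z = (x : ℂ)}

/-- The filter `t → a`, `t > a`, on the real line (it is `atBot` for `a = ⊥`). -/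
noncomputable def toLeftEnd (a : EReal) : Filter ℝ := comap (fun t : ℝ => (t : EReal)) (𝓝[>] a)

/-- The filter `t → b`, `t < b`, on the real line (it is `atTop` for `b = ⊤`). -/
noncomputable def toRightEnd (b : EReal) : Filter ℝ := comap (fun t : ℝ => (t : EReal)) (𝓝[<] b)

variable {N : ℕ}

/-- A real matrix function regarded as a complex one. -/
def cW (W : ℝ → Matrix (Fin N) (Fin N) ℝ) (x : ℝ) : Matrix (Fin N) (Fin N) ℂ :=
  (W x).map (fun r : ℝ => (r : ℂ))

/-- The entrywise derivative of a matrix function. -/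
noncomputable def derivW (W : ℝ → Matrix (Fin N) (Fin N) ℝ) (x : ℝ) :
    Matrix (Fin N) (Fin N) ℝ :=
  Matrix.of fun i j => deriv (fun t => W t i j) x

/-- Power-type behavior at a finite endpoint `c` of `(a, b)`: `W x = |x - c| ^ g • V x`, where
`g > -1` and `V` has a non-zero limit at `c`. -/
def PowerAt (a b : EReal) (W : ℝ → Matrix (Fin N) (Fin N) ℝ) (c g : ℝ) : Prop :=
  -1 < g ∧ ∃ (V : ℝ → Matrix (Fin N) (Fin N) ℝ) (L : Matrix (Fin N) (Fin N) ℝ),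
    (∀ x ∈ openInt a b, W x = (|x - c| ^ g) • V x) ∧
    L ≠ 0 ∧ Tendsto V (𝓝[openInt a b] c) (𝓝 L)

/-- Differentiable positive definite weights on `(a, b)` with finite moments. At the finite
endpoints among `a`, `b` they behave like a power with exponent `ga`, `gb` respectively
(an exponent at an infinite endpoint plays no role). -/
structure IsWeight (a b : EReal) (ga gb : ℝ) (W : ℝ → Matrix (Fin N) (Fin N) ℝ) : Prop where
  posDef : ∀ x ∈ openInt a b, (W x).PosDef
  differentiable : ∀ x ∈ openInt a b, ∀ i j, DifferentiableAt ℝ (fun t => W t i j) x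
  moments : ∀ (k : ℕ) (i j : Fin N), IntegrableOn (fun x => |x| ^ k * W x i j) (openInt a b)
  left_end : ∀ c : ℝ, (c : EReal) = a → PowerAt a b W c ga
  right_end : ∀ c : ℝ, (c : EReal) = b → PowerAt a b W c gb

/-- The value `∑ A_k z ^ k` at the scalar `z` of a matrix polynomial `∑ A_k X ^ k`. -/
noncomputable def val (P : (Matrix (Fin N) (Fin N) ℂ)[X]) (z : ℂ) : Matrix (Fin N) (Fin N) ℂ :=
  P.eval (algebraMap ℂ (Matrix (Fin N) (Fin N) ℂ) z)

/-- The entrywise integral `∫_a^b F(t) dt`. -/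
noncomputable def matInt (a b : EReal) (F : ℝ → Matrix (Fin N) (Fin N) ℂ) :
    Matrix (Fin N) (Fin N) ℂ :=
  Matrix.of fun i j => ∫ t in openInt a b, F t i j

/-- The matrix inner product `∫_a^b P(x) W(x) Q(x)^* dx`. -/
noncomputable def innerW (a b : EReal) (W : ℝ → Matrix (Fin N) (Fin N) ℝ)
    (P Q : (Matrix (Fin N) (Fin N) ℂ)[X]) : Matrix (Fin N) (Fin N) ℂ :=
  matInt a b fun x => val P x * cW W x * (val Q x)ᴴ

/-- `P n`, `n = 0, 1, …`, are the monic orthogonal polynomials of the weight `W`. -/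
def IsMonicOrthogonal (a b : EReal) (W : ℝ → Matrix (Fin N) (Fin N) ℝ)
    (P : ℕ → (Matrix (Fin N) (Fin N) ℂ)[X]) : Prop :=
  ∀ n, (P n).natDegree ≤ n ∧ (P n).coeff n = 1 ∧
    ∀ Q : (Matrix (Fin N) (Fin N) ℂ)[X], Q.natDegree < n → innerW a b W (P n) Q = 0

/-- The polynomials `κ n * P n` are orthonormal; for monic `P n` the matrices `κ n` are their
leading coefficients. -/
def IsNormalizedBy (a b : EReal) (W : ℝ → Matrix (Fin N) (Fin N) ℝ)
    (P : ℕ → (Matrix (Fin N) (Fin N) ℂ)[X]) (κ : ℕ → Matrix (Fin N) (Fin N) ℂ) : Prop :=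
  ∀ n m, innerW a b W (C (κ n) * P n) (C (κ m) * P m) = if n = m then 1 else 0

/-- `γ n = (κ n)^* κ n`. -/
noncomputable def gam (κ : ℕ → Matrix (Fin N) (Fin N) ℂ) (n : ℕ) : Matrix (Fin N) (Fin N) ℂ :=
  (κ n)ᴴ * κ n

/-- The term of index `n - 1` of a sequence, with the convention that the term of index `-1`
is zero. -/
def prev {α : Type*} [Zero α] (f : ℕ → α) : ℕ → α
  | 0 => 0
  | n + 1 => f n

/-- `F^*(z) = (F(conj z))^*`. -/
def conjStar (F : ℂ → Matrix (Fin N) (Fin N) ℂ) (z : ℂ) : Matrix (Fin N) (Fin N) ℂ :=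
  (F ((starRingEnd ℂ) z))ᴴ

/-! ### The Riemann-Hilbert problem -/

/-- The comparison function at a finite endpoint `c` with exponent `g`. -/
noncomputable def endGrowth (c g : ℝ) (z : ℂ) : ℝ :=
  if g < 0 then ‖z - (c : ℂ)‖ ^ g else if g = 0 then Real.log ‖z - (c : ℂ)‖ else 1

/-- As `z → c`, the first block column of `Y` is `O(1)`, the second one is `O(endGrowth)`. -/
def EndBound (a b : EReal) (c g : ℝ) (Y : ℂ → Matrix (Fin N ⊕ Fin N) (Fin N ⊕ Fin N) ℂ) :
    Prop :=
  ∀ (i : Fin N ⊕ Fin N) (j : Fin N),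
    (fun z => Y z i (Sum.inl j)) =O[𝓝[offInt a b] (c : ℂ)] (fun _ => (1 : ℝ)) ∧
    (fun z => Y z i (Sum.inr j)) =O[𝓝[offInt a b] (c : ℂ)] endGrowth c g

/-- `Y` solves the Riemann-Hilbert problem of index `n` for the weight `W`.
Only the values of `Y` on `ℂ \ [a, b]` matter. In `at_infinity` the relation
`Y = (I + ∑ Y_i / z ^ i + O(1 / z ^ (m + 1))) diag(z ^ n, z ^ (-n))` is written with the diagonal
factor moved to the left-hand side. -/
structure IsRHSolution (a b : EReal) (ga gb : ℝ) (W : ℝ → Matrix (Fin N) (Fin N) ℝ) (n : ℕ)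
    (Y : ℂ → Matrix (Fin N ⊕ Fin N) (Fin N ⊕ Fin N) ℂ) : Prop where
  analytic : ∀ i j, AnalyticOnNhd ℂ (fun z => Y z i j) (offInt a b)
  jump : ∃ Yp Ym : ℝ → Matrix (Fin N ⊕ Fin N) (Fin N ⊕ Fin N) ℂ,
    ContinuousOn Yp (openInt a b) ∧ ContinuousOn Ym (openInt a b) ∧
    (∀ x ∈ openInt a b, Tendsto Y (𝓝[{z : ℂ | 0 < z.im}] (x : ℂ)) (𝓝 (Yp x))) ∧
    (∀ x ∈ openInt a b, Tendsto Y (𝓝[{z : ℂ | z.im < 0}] (x : ℂ)) (𝓝 (Ym x))) ∧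
    ∀ x ∈ openInt a b, Yp x = Ym x * fromBlocks 1 (cW W x) 0 1
  at_infinity : ∃ Yc : ℕ → Matrix (Fin N ⊕ Fin N) (Fin N ⊕ Fin N) ℂ, ∀ (m : ℕ) i j,
    (fun z : ℂ => (Y z * fromBlocks (((z ^ n)⁻¹) • 1) 0 0 ((z ^ n) • 1)
        - (1 + ∑ k ∈ Finset.Icc 1 m, ((z ^ k)⁻¹) • Yc k) :
          Matrix (Fin N ⊕ Fin N) (Fin N ⊕ Fin N) ℂ) i j)
      =O[Bornology.cobounded ℂ ⊓ 𝓟 (offInt a b)] (fun z : ℂ => (z ^ (m + 1))⁻¹)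
  left_end : ∀ c : ℝ, (c : EReal) = a → EndBound a b c ga Y
  right_end : ∀ c : ℝ, (c : EReal) = b → EndBound a b c gb Y

/-! ### The coefficients of the differential equation -/

/-- The integrand `P(t) W'(t) Q(t)^* / (t - z)`. -/
noncomputable def integrand (W : ℝ → Matrix (Fin N) (Fin N) ℝ)
    (P Q : (Matrix (Fin N) (Fin N) ℂ)[X]) (z : ℂ) (t : ℝ) : Matrix (Fin N) (Fin N) ℂ :=
  ((t : ℂ) - z)⁻¹ • (val P t * cW (derivW W) t * (val Q t)ᴴ)

/-- The function `P(t) W(t) Q(t)^* / (t - z)` of the boundary terms. -/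
noncomputable def boundaryFun (W : ℝ → Matrix (Fin N) (Fin N) ℝ)
    (P Q : (Matrix (Fin N) (Fin N) ℂ)[X]) (z : ℂ) (t : ℝ) : Matrix (Fin N) (Fin N) ℂ :=
  ((t : ℂ) - z)⁻¹ • (val P t * cW W t * (val Q t)ᴴ)

/-- The integral and both boundary values in `cauchyTerm` exist at `z`. -/
def TermExists (a b : EReal) (W : ℝ → Matrix (Fin N) (Fin N) ℝ)
    (P Q : (Matrix (Fin N) (Fin N) ℂ)[X]) (z : ℂ) : Prop :=
  (∀ i j, IntegrableOn (fun t => integrand W P Q z t i j) (openInt a b)) ∧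
  (∃ L, Tendsto (boundaryFun W P Q z) (toLeftEnd a) (𝓝 L)) ∧
  (∃ L, Tendsto (boundaryFun W P Q z) (toRightEnd b) (𝓝 L))

/-- `∫_a^b P W' Q^* / (t - z) dt - [P W Q^* / (t - z)]_{t = a}^{t = b}`, the values at the
endpoints being limits from within the interval. -/
noncomputable def cauchyTerm (a b : EReal) (W : ℝ → Matrix (Fin N) (Fin N) ℝ)
    (P Q : (Matrix (Fin N) (Fin N) ℂ)[X]) (z : ℂ) : Matrix (Fin N) (Fin N) ℂ :=
  matInt a b (integrand W P Q z) -
    (limUnder (toRightEnd b) (boundaryFun W P Q z) - limUnder (toLeftEnd a) (boundaryFun W P Q z))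

/-- `𝔄(z) = -γ (∫ P W' P^* / (t - z) dt - [P W P^* / (t - z)])`. -/
noncomputable def frakA (a b : EReal) (W : ℝ → Matrix (Fin N) (Fin N) ℝ)
    (P : (Matrix (Fin N) (Fin N) ℂ)[X]) (γ : Matrix (Fin N) (Fin N) ℂ) (z : ℂ) :
    Matrix (Fin N) (Fin N) ℂ :=
  -(γ * cauchyTerm a b W P P z)

/-- `𝔅(z) = -(∫ P W' Q^* / (t - z) dt - [P W Q^* / (t - z)]) γ`. -/
noncomputable def frakB (a b : EReal) (W : ℝ → Matrix (Fin N) (Fin N) ℝ)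
    (P Q : (Matrix (Fin N) (Fin N) ℂ)[X]) (γ : Matrix (Fin N) (Fin N) ℂ) (z : ℂ) :
    Matrix (Fin N) (Fin N) ℂ :=
  -(cauchyTerm a b W P Q z * γ)

/-- The coefficient matrix of the differential equation of index `n`. -/
noncomputable def coeffF (a b : EReal) (W : ℝ → Matrix (Fin N) (Fin N) ℝ)
    (P : ℕ → (Matrix (Fin N) (Fin N) ℂ)[X]) (κ : ℕ → Matrix (Fin N) (Fin N) ℂ) (n : ℕ) (z : ℂ) :
    Matrix (Fin N ⊕ Fin N) (Fin N ⊕ Fin N) ℂ :=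
  fromBlocks
    (-frakB a b W (P n) (prev P n) (prev (gam κ) n) z)
    (-((1 / (2 * (Real.pi : ℂ) * Complex.I)) • ((gam κ n)⁻¹ * frakA a b W (P n) (gam κ n) z)))
    ((2 * (Real.pi : ℂ) * Complex.I) •
      (frakA a b W (prev P n) (prev (gam κ) n) z * prev (gam κ) n))
    (conjStar (frakB a b W (P n) (prev P n) (prev (gam κ) n)) z)

end MOPRL

/-! The hypotheses at the cut, at infinity and at the endpoints determine `Y` completely. The first
block column has no jump and grows polynomially, so it consists of polynomials. The second column
then jumps by polynomial times `W`, and where it decays it is the Cauchy transform of that jump. Its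
decay of order `z ^ (-n)` forces the low moments to vanish. Orthogonality then identifies the rows
with `P n` and `-2πi γ_{n-1} P_{n-1}`, each paired with its Cauchy transform (`eq_fromBlocks_succ`,
`eq_fromBlocks_zero`). The analytic input is `CutFunction.eq_cauchy`: a function with prescribed
jump, integrable endpoint singularities and decay `O(1/z)` is a Cauchy integral. It follows from
Cauchy's theorem in the two half planes.

The rest is algebra. Integration by parts removes `W'` from `∫ P_r W' P_s^* / (t - z)`, and the
boundary values in the definition of the coefficients are exactly those it produces
(`cauchyTerm_eq`). Expanding the polynomials around `z` and `conj z`, orthogonality kills all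
remainders when `|r - s| ≤ 1`, and what is left is linear in `P_r'(z)` and in the derivative of the
Cauchy transform of `P_r W` (`cauchyTerm_eq_of_orth`). For `s = m` and `s = m + 1` this gives two
equations for two unknowns. The system is solved by Wronskian relations, the matrix analogue of `det
Y = 1` (`wronskian_blocks`, `linear_system`). The resulting coefficients are those of the
differential equation.

The symmetry relation, and the entry `𝔅_n^*`, come from conjugation: `W` is symmetric and `t` is
real, so the adjoint of a term at `conj z` is the term at `z` with the two polynomials exchanged
(`termExists_conj`). -/

namespace MOPRL

/-! ### Contour integrals over the boundary of a half plane -/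

/-- Decay of order `‖w‖ ^ (-2)` at infinity in the upper half plane. -/
def UpperDecay (H : ℂ → ℂ) : Prop :=
  ∃ C R : ℝ, 0 ≤ C ∧ 1 ≤ R ∧ ∀ w : ℂ, 0 < w.im → R ≤ ‖w‖ → ‖H w‖ ≤ C / ‖w‖ ^ 2

theorem continuous_horizontal_line {H : ℂ → ℂ} (hd : DifferentiableOn ℂ H {w | 0 < w.im})
    {ε : ℝ} (hε : 0 < ε) : Continuous fun x : ℝ => H (x + ε * Complex.I) := by
  have hc : Continuous fun x : ℝ => (x : ℂ) + ε * Complex.I := by fun_prop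
  exact hd.continuousOn.comp_continuous hc fun x => by simpa using hε

/-- The bound is uniform in `ε`, so it can dominate the tails as the line descends to the real axis.
-/
theorem UpperDecay.tail_bound {H : ℂ → ℂ} (h : UpperDecay H) :
    ∃ C R : ℝ, 0 ≤ C ∧ ∀ ε : ℝ, 0 < ε → ∀ x : ℝ, R ≤ |x| →
      ‖H (x + ε * Complex.I)‖ ≤ C * (1 + x ^ 2)⁻¹ := by
  obtain ⟨C, R, hC, hR, hb⟩ := h
  refine ⟨2 * C, R, by positivity, fun ε hε x hx => ?_⟩
  have h1 : |x| ≤ ‖(x : ℂ) + ε * Complex.I‖ := by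
    simpa using Complex.abs_re_le_norm ((x : ℂ) + ε * Complex.I)
  have h2 := hb ((x : ℂ) + ε * Complex.I) (by simpa using hε) (hx.trans h1)
  refine h2.trans ?_
  have h3 : 1 ≤ |x| := hR.trans hx
  have h4 : x ^ 2 ≤ ‖(x : ℂ) + ε * Complex.I‖ ^ 2 := by
    rw [← sq_abs x]; gcongr
  have h5 : 1 ≤ x ^ 2 := by rw [← sq_abs x]; nlinarith
  rw [← div_eq_mul_inv, div_le_div_iff₀ (by linarith) (by positivity)]
  nlinarith

theorem UpperDecay.integrable_line {H : ℂ → ℂ} (h : UpperDecay H)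
    (hd : DifferentiableOn ℂ H {w | 0 < w.im}) {ε : ℝ} (hε : 0 < ε) :
    Integrable fun x : ℝ => H (x + ε * Complex.I) := by
  obtain ⟨C, R, hC, hb⟩ := h.tail_bound
  have hc := continuous_horizontal_line hd hε
  have h1 : IntegrableOn (fun x : ℝ => H (x + ε * Complex.I)) (Set.Icc (-R) R) :=
    hc.continuousOn.integrableOn_Icc
  have h2 : IntegrableOn (fun x : ℝ => H (x + ε * Complex.I)) (Set.Icc (-R) R)ᶜ := by
    refine Integrable.mono' (g := fun x => C * (1 + x ^ 2)⁻¹)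
      (integrable_inv_one_add_sq.const_mul C).integrableOn hc.aestronglyMeasurable ?_
    refine (ae_restrict_mem measurableSet_Icc.compl).mono fun x hx => hb ε hε x ?_
    by_contra hlt
    exact hx (abs_le.1 (not_le.1 hlt).le)
  simpa using h1.union h2

/-- Cauchy's theorem on the rectangle `[-r, r] × [ε, r]`: the other three sides have length `O(r)`,
and there the integrand is `O(r ^ (-2))`. -/
theorem UpperDecay.integral_line_eq_zero {H : ℂ → ℂ} (h : UpperDecay H)
    (hd : DifferentiableOn ℂ H {w | 0 < w.im}) {ε : ℝ} (hε : 0 < ε) :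
    ∫ x : ℝ, H (x + ε * Complex.I) = 0 := by
  have hlim := intervalIntegral_tendsto_integral (h.integrable_line hd hε)
    tendsto_neg_atTop_atBot tendsto_id
  refine tendsto_nhds_unique hlim ?_
  obtain ⟨C, R, hC, hR, hb⟩ := h
  -- The top side contributes at most `2C/r`, each vertical side at most `C/r`.
  have hz : Tendsto (fun r : ℝ => 4 * C / r) atTop (𝓝 0) :=
    tendsto_const_nhds.div_atTop tendsto_id
  refine squeeze_zero_norm' ?_ hz
  filter_upwards [eventually_ge_atTop R, eventually_ge_atTop ε] with r hr hre
  have hr0 : 0 < r := by linarith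
  have key := Complex.integral_boundary_rect_eq_zero_of_differentiableOn H
    (⟨-r, ε⟩ : ℂ) (⟨r, r⟩ : ℂ) (hd.mono ?_)
  swap
  · intro w hw
    have := hw.2
    simp only [Set.mem_preimage, Set.uIcc_of_le hre] at this
    exact lt_of_lt_of_le hε this.1
  simp only [id]
  have hB : ∀ w : ℂ, 0 < w.im → r ≤ ‖w‖ → ‖H w‖ ≤ C / r ^ 2 := by
    intro w hw hrw
    refine (hb w hw (hr.trans hrw)).trans ?_
    gcongr
  have e1 : ‖∫ x : ℝ in (-r)..r, H (x + r * Complex.I)‖ ≤ C / r ^ 2 * |r - (-r)| := by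
    refine intervalIntegral.norm_integral_le_of_norm_le_const fun x _ => hB _ (by simpa) ?_
    simpa [abs_of_pos hr0] using Complex.abs_im_le_norm ((x : ℂ) + r * Complex.I)
  have e2 : ∀ s : ℝ, |s| = r →
      ‖∫ y : ℝ in ε..r, H ((s : ℂ) + y * Complex.I)‖ ≤ C / r ^ 2 * |r - ε| := by
    intro s hs
    refine intervalIntegral.norm_integral_le_of_norm_le_const fun y hy => hB _ ?_ ?_
    · rw [Set.uIoc_of_le hre] at hy
      simpa using hε.trans hy.1
    · simpa [hs] using Complex.abs_re_le_norm ((s : ℂ) + y * Complex.I)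
  have e3 := e2 r (abs_of_pos hr0)
  have e4 := e2 (-r) (by simp [abs_of_pos hr0])
  simp only at key
  have hE : ∫ x : ℝ in (-r)..r, H (x + ε * Complex.I) =
      (∫ x : ℝ in (-r)..r, H (x + r * Complex.I))
        - Complex.I • (∫ y : ℝ in ε..r, H ((r : ℂ) + y * Complex.I))
        + Complex.I • (∫ y : ℝ in ε..r, H (((-r : ℝ) : ℂ) + y * Complex.I)) := by
    linear_combination key
  rw [hE]
  refine (norm_add_le _ _).trans ?_
  refine (add_le_add_left (norm_sub_le _ _) _).trans ?_
  rw [norm_smul, norm_smul, Complex.norm_I, one_mul, one_mul]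
  have a1 : |r - (-r)| = 2 * r := by rw [abs_of_nonneg] <;> linarith
  have a2 : |r - ε| ≤ r := by rw [abs_of_nonneg] <;> linarith
  have a3 : C / r ^ 2 * |r - ε| ≤ C / r ^ 2 * r := by gcongr
  have a4 : 4 * C / r = C / r ^ 2 * (2 * r) + C / r ^ 2 * r + C / r ^ 2 * r := by
    field_simp; ring
  rw [a1] at e1
  rw [a4]
  linarith

/-- A local bound by an integrable power near each real point, from the upper half plane. -/
def UpperLocal (H : ℂ → ℂ) : Prop :=
  ∀ x : ℝ, ∃ g : ℝ, -1 < g ∧ g ≤ 0 ∧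
    H =O[𝓝[{w : ℂ | 0 < w.im}] (x : ℂ)] fun w => ‖w - x‖ ^ g

theorem integrableOn_closedBall_abs_sub_rpow {g : ℝ} (hg : -1 < g) (c r : ℝ) :
    IntegrableOn (fun x : ℝ => |x - c| ^ g) (Metric.closedBall c r) := by
  have h0 : LocallyIntegrable fun x : ℝ => |x| ^ g := by
    refine locallyIntegrable_of_norm_le_rpow (C := 1) (α := -g) (by simp) (by simp; linarith) ?_ ?_
    · refine Eventually.of_forall fun x => ?_
      rw [Real.norm_of_nonneg (by positivity)]
      simp
    · exact (measurable_norm.pow_const g).aestronglyMeasurable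
  have h1 := (h0.integrableOn_isCompact (isCompact_closedBall 0 r)).integrable_indicator
    Metric.isClosed_closedBall.measurableSet
  rw [← integrable_indicator_iff Metric.isClosed_closedBall.measurableSet]
  refine (h1.comp_sub_right c).congr (Eventually.of_forall fun x => ?_)
  simp only [Set.indicator, Metric.mem_closedBall, dist_zero_right, Real.dist_eq, Real.norm_eq_abs]

/-- Near `c` the majorant is `C |x - c| ^ g`. It serves all low horizontal lines at once, because `g
≤ 0` and `|w - c| ≥ |re w - c|`. Compactness patches the local majorants together. -/
theorem UpperLocal.compact_bound {H : ℂ → ℂ} (h : UpperLocal H) {K : Set ℝ} (hK : IsCompact K) :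
    ∃ k : ℝ → ℝ, Integrable k ∧ (∀ x, 0 ≤ k x) ∧ ∀ᶠ ε : ℝ in 𝓝[>] 0, ∀ᵐ x : ℝ, x ∈ K →
      ‖H (x + ε * Complex.I)‖ ≤ k x := by
  refine hK.induction_on (p := fun s => ∃ k : ℝ → ℝ, Integrable k ∧ (∀ x, 0 ≤ k x) ∧
    ∀ᶠ ε : ℝ in 𝓝[>] 0, ∀ᵐ x : ℝ, x ∈ s → ‖H (x + ε * Complex.I)‖ ≤ k x) ?_ ?_ ?_ ?_
  · exact ⟨0, integrable_zero _ _ _, fun _ => le_rfl, by simp⟩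
  · rintro s t hst ⟨k, h1, h2, h3⟩
    exact ⟨k, h1, h2, h3.mono fun ε hε => hε.mono fun x hx hs => hx (hst hs)⟩
  · rintro s t ⟨k, h1, h2, h3⟩ ⟨k', h1', h2', h3'⟩
    refine ⟨k + k', h1.add h1', fun x => add_nonneg (h2 x) (h2' x), ?_⟩
    filter_upwards [h3, h3'] with ε hε hε'
    filter_upwards [hε, hε'] with x hx hx'
    rintro (hs | ht)
    · exact (hx hs).trans (le_add_of_nonneg_right (h2' x))
    · exact (hx' ht).trans (le_add_of_nonneg_left (h2 x))
  · intro c _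
    obtain ⟨g, hg, hg0, hO⟩ := h c
    obtain ⟨C, hC, hO⟩ := hO.exists_pos
    rw [Asymptotics.isBigOWith_iff, eventually_nhdsWithin_iff, Metric.eventually_nhds_iff] at hO
    obtain ⟨δ, hδ, hO⟩ := hO
    refine ⟨Metric.ball c (δ / 2), mem_nhdsWithin_of_mem_nhds
      (Metric.ball_mem_nhds c (by positivity)),
      (Metric.closedBall c (δ / 2)).indicator fun x => C * |x - c| ^ g, ?_, ?_, ?_⟩
    · rw [integrable_indicator_iff Metric.isClosed_closedBall.measurableSet]
      exact (integrableOn_closedBall_abs_sub_rpow hg c _).const_mul C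
    · intro x
      exact Set.indicator_nonneg (fun x _ => by positivity) x
    · filter_upwards [Ioo_mem_nhdsGT (show (0:ℝ) < δ / 2 by positivity)] with ε hε
      -- For `g < 0` the convention `0 ^ g = 0` would make the majorant vanish at `c`, so this point
      -- is discarded.
      have hne : ∀ᵐ x : ℝ, x ≠ c := by
        simp [ae_iff]
      filter_upwards [hne] with x hx hxs
      rw [Set.indicator_of_mem (Metric.ball_subset_closedBall hxs)]
      have hd : dist ((x : ℂ) + ε * Complex.I) c < δ := by
        rw [dist_eq_norm]
        have : (x : ℂ) + ε * Complex.I - c = ((x - c : ℝ) : ℂ) + ε * Complex.I := by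
          push_cast; ring
        rw [this]
        refine (norm_add_le _ _).trans_lt ?_
        rw [norm_mul, Complex.norm_I, Complex.norm_real, Complex.norm_real, mul_one,
          Real.norm_eq_abs, Real.norm_eq_abs, abs_of_pos hε.1]
        have := Metric.mem_ball.1 hxs
        rw [Real.dist_eq] at this
        linarith [hε.2]
      have h1 := hO hd (by simpa using hε.1)
      refine h1.trans ?_
      rw [Real.norm_of_nonneg (by positivity)]
      refine mul_le_mul_of_nonneg_left ?_ hC.le
      refine Real.rpow_le_rpow_of_nonpos (abs_pos.2 (sub_ne_zero.2 hx)) ?_ hg0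
      simpa using Complex.abs_re_le_norm ((x : ℂ) + ε * Complex.I - c)

/-- The integral of the boundary values on the real line of a function on the upper half plane
vanishes. -/
theorem integral_upper_boundary {H : ℂ → ℂ} (hd : DifferentiableOn ℂ H {w | 0 < w.im})
    (hdec : UpperDecay H) (hloc : UpperLocal H) {h : ℝ → ℂ}
    (hlim : ∀ᵐ x : ℝ, Tendsto H (𝓝[{w : ℂ | 0 < w.im}] (x : ℂ)) (𝓝 (h x))) :
    Integrable h ∧ ∫ x, h x = 0 := by
  obtain ⟨C, R, hC, hb⟩ := hdec.tail_bound
  obtain ⟨k, hk, hk0, hkb⟩ := hloc.compact_bound (isCompact_Icc (a := -R) (b := R))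
  have hbound : ∀ᶠ ε : ℝ in 𝓝[>] 0, ∀ᵐ x : ℝ,
      ‖H (x + ε * Complex.I)‖ ≤ k x + C * (1 + x ^ 2)⁻¹ := by
    filter_upwards [hkb, self_mem_nhdsWithin] with ε hε hpos
    filter_upwards [hε] with x hx
    have hnn : 0 ≤ C * (1 + x ^ 2)⁻¹ := by positivity
    by_cases hxR : x ∈ Set.Icc (-R) R
    · linarith [hx hxR]
    · have := hb ε hpos x (by
        by_contra hlt
        exact hxR (abs_le.1 (not_le.1 hlt).le))
      linarith [hk0 x]
  have hlim' : ∀ᵐ x : ℝ, Tendsto (fun ε : ℝ => H (x + ε * Complex.I)) (𝓝[>] 0) (𝓝 (h x)) := by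
    filter_upwards [hlim] with x hx
    refine hx.comp (tendsto_nhdsWithin_iff.2 ⟨?_, ?_⟩)
    · have : Continuous fun ε : ℝ => (x : ℂ) + ε * Complex.I := by fun_prop
      exact (this.tendsto' 0 (x : ℂ) (by simp)).mono_left nhdsWithin_le_nhds
    · filter_upwards [self_mem_nhdsWithin] with ε hε
      simpa using hε
  have hmeas : ∀ᶠ ε : ℝ in 𝓝[>] 0,
      AEStronglyMeasurable (fun x : ℝ => H (x + ε * Complex.I)) volume := by
    filter_upwards [self_mem_nhdsWithin] with ε hε
    exact (continuous_horizontal_line hd hε).aestronglyMeasurable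
  have hK : Integrable fun x => k x + C * (1 + x ^ 2)⁻¹ :=
    hk.add (integrable_inv_one_add_sq.const_mul C)
  constructor
  -- Passing to a sequence of heights gives measurability of the limit and leaves only countably
  -- many exceptional null sets to unite.
  · let u : ℕ → ℝ := fun n => 1 / ((n : ℝ) + 1)
    have hu : Tendsto u atTop (𝓝[>] 0) :=
      tendsto_nhdsWithin_iff.2 ⟨tendsto_one_div_add_atTop_nhds_zero_nat,
        Eventually.of_forall fun n => by simp only [u, Set.mem_Ioi]; positivity⟩
    have hm : AEStronglyMeasurable h volume := by
      refine aestronglyMeasurable_of_tendsto_ae atTop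
        (f := fun (n : ℕ) (x : ℝ) => H (x + u n * Complex.I)) (fun n => ?_) ?_
      · exact (continuous_horizontal_line hd
          (by simp only [u]; positivity)).aestronglyMeasurable
      · filter_upwards [hlim'] with x hx using hx.comp hu
    refine hK.mono' hm ?_
    have hall : ∀ᶠ n in atTop, ∀ᵐ x : ℝ,
      ‖H (x + u n * Complex.I)‖ ≤ k x + C * (1 + x ^ 2)⁻¹ := hu.eventually hbound
    obtain ⟨n₀, hn₀⟩ := eventually_atTop.1 hall
    have hall' : ∀ᵐ x : ℝ, ∀ n, n₀ ≤ n →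
      ‖H (x + u n * Complex.I)‖ ≤ k x + C * (1 + x ^ 2)⁻¹ := by
      rw [ae_all_iff]; intro n
      by_cases hn : n₀ ≤ n
      · filter_upwards [hn₀ n hn] with x hx _ using hx
      · exact Eventually.of_forall fun x h => absurd h hn
    filter_upwards [hall', hlim'] with x hx hxl
    refine le_of_tendsto (hxl.comp hu).norm ?_
    filter_upwards [eventually_ge_atTop n₀] with n hn using hx n hn
  · have hT := tendsto_integral_filter_of_dominated_convergence _ hmeas hbound hK hlim'
    refine tendsto_nhds_unique hT (tendsto_const_nhds.congr' ?_)
    filter_upwards [self_mem_nhdsWithin] with ε hε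
    exact (hdec.integral_line_eq_zero hd hε).symm

/-! ### The domain `ℂ \ [a, b]` -/

theorem isOpen_offInt (a b : EReal) : IsOpen (offInt a b) := by
  have h : offInt a b = ((fun x : ℝ => (x : ℂ)) '' {x : ℝ | a ≤ (x : EReal) ∧ (x : EReal) ≤ b})ᶜ := by
    ext z
    simp only [offInt, Set.mem_ofPred_eq, Set.mem_compl_iff, Set.mem_image, and_assoc, eq_comm]
  rw [h, isOpen_compl_iff]
  refine Complex.isometry_ofReal.isClosedEmbedding.isClosedMap _ ?_
  exact (isClosed_le continuous_const continuous_coe_real_ereal).inter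
    (isClosed_le continuous_coe_real_ereal continuous_const)

theorem mem_offInt_of_im_ne {a b : EReal} {z : ℂ} (h : z.im ≠ 0) : z ∈ offInt a b := by
  rintro ⟨x, -, -, rfl⟩
  simp at h

theorem ofReal_notMem_offInt {a b : EReal} {x : ℝ} (h : a ≤ x) (h' : (x : EReal) ≤ b) :
    (x : ℂ) ∉ offInt a b := fun hx => hx ⟨x, h, h', rfl⟩

theorem measurableSet_openInt (a b : EReal) : MeasurableSet (openInt a b) :=
  ((isOpen_lt continuous_const continuous_coe_real_ereal).inter
    (isOpen_lt continuous_coe_real_ereal continuous_const)).measurableSet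

theorem isOpen_openInt (a b : EReal) : IsOpen (openInt a b) :=
  (isOpen_lt continuous_const continuous_coe_real_ereal).inter
    (isOpen_lt continuous_coe_real_ereal continuous_const)

theorem mem_offInt_or (a b : EReal) (x : ℝ) :
    x ∈ openInt a b ∨ ((x : EReal) = a ∨ (x : EReal) = b) ∨ (x : ℂ) ∈ offInt a b := by
  rcases lt_trichotomy (x : EReal) a with h | h | h
  · right; right
    rintro ⟨y, hy, -, hxy⟩
    rw [← Complex.ofReal_inj.1 hxy] at hy
    exact absurd h (not_lt.2 hy)
  · exact Or.inr (Or.inl (Or.inl h))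
  · rcases lt_trichotomy (x : EReal) b with h' | h' | h'
    · exact Or.inl ⟨h, h'⟩
    · exact Or.inr (Or.inl (Or.inr h'))
    · right; right
      rintro ⟨y, -, hy, hxy⟩
      rw [← Complex.ofReal_inj.1 hxy] at hy
      exact absurd h' (not_lt.2 hy)

theorem ae_ne_endpoints (a b : EReal) : ∀ᵐ x : ℝ, ¬ ((x : EReal) = a ∨ (x : EReal) = b) := by
  have h : ∀ c : EReal, ∀ᵐ x : ℝ, (x : EReal) ≠ c := by
    intro c
    have : ∀ᵐ x : ℝ, x ≠ c.toReal := by simp [ae_iff]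
    filter_upwards [this] with x hx hxc
    exact hx (by simp [← hxc])
  filter_upwards [h a, h b] with x h1 h2
  tauto

theorem neg_mem_offInt {a b : EReal} {w : ℂ} (h : w ∈ offInt (-b) (-a)) : -w ∈ offInt a b := by
  rintro ⟨x, h1, h2, h3⟩
  refine h ⟨-x, ?_, ?_, ?_⟩
  · rw [EReal.coe_neg]; exact EReal.neg_le_neg_iff.2 h2
  · rw [EReal.coe_neg]; exact EReal.neg_le_neg_iff.2 h1
  · rw [Complex.ofReal_neg, ← h3, neg_neg]

theorem conj_mem_offInt {a b : EReal} {w : ℂ} (h : w ∈ offInt a b) :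
    (starRingEnd ℂ) w ∈ offInt a b := by
  rintro ⟨x, h1, h2, h3⟩
  refine h ⟨x, h1, h2, ?_⟩
  rw [← Complex.conj_conj w, h3, Complex.conj_ofReal]

/-! ### Functions with a prescribed jump across the interval -/

/-- `F` is analytic off `[a, b]`, jumps by `f` across `(a, b)`, and has singularities of
order less than one at the endpoints. -/
structure CutFunction (a b : EReal) (F : ℂ → ℂ) (f : ℝ → ℂ) : Prop where
  diff : DifferentiableOn ℂ F (offInt a b)
  jump : ∀ x ∈ openInt a b, ∃ p m : ℂ,
    Tendsto F (𝓝[{w : ℂ | 0 < w.im}] (x : ℂ)) (𝓝 p) ∧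
    Tendsto F (𝓝[{w : ℂ | w.im < 0}] (x : ℂ)) (𝓝 m) ∧ p - m = f x
  endpoint : ∀ c : ℝ, ((c : EReal) = a ∨ (c : EReal) = b) → ∃ g : ℝ, -1 < g ∧ g ≤ 0 ∧
    F =O[𝓝[offInt a b] (c : ℂ)] fun w => ‖w - c‖ ^ g

/-- Since `g ≤ 0`, the constant `1` is `O(‖w - x‖ ^ g)` near `x`, so a bounded additive term does no
harm. This is why endpoint exponents are normalized to be nonpositive. -/
theorem isBigO_affine {l : Filter ℂ} {x : ℂ} {g : ℝ} (hl : l ≤ 𝓝 x) (hne : ∀ᶠ w in l, w ≠ x)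
    (hg : g ≤ 0) {F H α β : ℂ → ℂ} (hF : F =O[l] fun w => ‖w - x‖ ^ g)
    (hα : ContinuousAt α x) (hβ : ContinuousAt β x) (hH : ∀ᶠ w in l, H w = α w * F w + β w) :
    H =O[l] fun w => ‖w - x‖ ^ g := by
  have h1 : (fun _ : ℂ => (1 : ℝ)) =O[l] fun w => ‖w - x‖ ^ g := by
    refine Asymptotics.IsBigO.of_bound 1 ?_
    have hb : ∀ᶠ w in l, w ∈ Metric.ball x 1 := hl (Metric.ball_mem_nhds x one_pos)
    filter_upwards [hne, hb] with w hw hwb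
    rw [norm_one, one_mul, Real.norm_of_nonneg (by positivity)]
    refine Real.one_le_rpow_of_pos_of_le_one_of_nonpos (norm_pos_iff.2 (sub_ne_zero.2 hw)) ?_ hg
    rw [← dist_eq_norm]
    exact (Metric.mem_ball.1 hwb).le
  have h2 : α =O[l] fun _ => (1 : ℝ) := (hα.tendsto.isBigO_one ℝ).mono hl
  have h3 : β =O[l] fun _ => (1 : ℝ) := (hβ.tendsto.isBigO_one ℝ).mono hl
  have h4 : (fun w => α w * F w) =O[l] fun w => ‖w - x‖ ^ g := by
    simpa using h2.mul hF
  exact (h4.add (h3.trans h1)).congr' (hH.mono fun w hw => hw.symm) EventuallyEq.rfl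

theorem eventually_ne_of_im_pos (x : ℝ) : ∀ᶠ w : ℂ in 𝓝[{w : ℂ | 0 < w.im}] (x : ℂ), w ≠ x := by
  filter_upwards [self_mem_nhdsWithin] with w hw h
  rw [h] at hw
  simp at hw

theorem upper_subset_offInt (a b : EReal) : {w : ℂ | 0 < w.im} ⊆ offInt a b :=
  fun _ hw => mem_offInt_of_im_ne (ne_of_gt hw)

theorem lower_subset_offInt (a b : EReal) : {w : ℂ | w.im < 0} ⊆ offInt a b :=
  fun _ hw => mem_offInt_of_im_ne (ne_of_lt hw)

theorem UpperLocal.affine {F H α β : ℂ → ℂ} (hF : UpperLocal F)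
    (hα : ∀ x : ℝ, ContinuousAt α x) (hβ : ∀ x : ℝ, ContinuousAt β x)
    (hH : ∀ x : ℝ, ∀ᶠ w in 𝓝 (x : ℂ), H w = α w * F w + β w) : UpperLocal H := by
  intro x
  obtain ⟨g, hg, hg0, hO⟩ := hF x
  exact ⟨g, hg, hg0, isBigO_affine nhdsWithin_le_nhds (eventually_ne_of_im_pos x) hg0 hO
    (hα x) (hβ x) (nhdsWithin_le_nhds (hH x))⟩

namespace CutFunction

variable {a b : EReal} {F : ℂ → ℂ} {f : ℝ → ℂ}

theorem affine (hF : CutFunction a b F f) {H α β : ℂ → ℂ}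
    (hα : ∀ x : ℝ, ContinuousAt α x) (hβ : ∀ x : ℝ, ContinuousAt β x)
    (hd : DifferentiableOn ℂ H (offInt a b))
    (hab : a ≤ b)
    (hH : ∀ x : ℝ, ∀ᶠ w in 𝓝 (x : ℂ), H w = α w * F w + β w) :
    CutFunction a b H fun x => α x * f x := by
  refine ⟨hd, fun x hx => ?_, fun c hc => ?_⟩
  · obtain ⟨p, m, hp, hm, hpm⟩ := hF.jump x hx
    have h1 := (((hα x).tendsto.mono_left nhdsWithin_le_nhds).mul hp).add
      ((hβ x).tendsto.mono_left nhdsWithin_le_nhds)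
    have h2 := (((hα x).tendsto.mono_left nhdsWithin_le_nhds).mul hm).add
      ((hβ x).tendsto.mono_left nhdsWithin_le_nhds)
    refine ⟨_, _, h1.congr' ?_, h2.congr' ?_, ?_⟩
    · exact nhdsWithin_le_nhds ((hH x).mono fun w hw => hw.symm)
    · exact nhdsWithin_le_nhds ((hH x).mono fun w hw => hw.symm)
    · rw [← hpm]; ring
  · obtain ⟨g, hg, hg0, hO⟩ := hF.endpoint c hc
    refine ⟨g, hg, hg0, isBigO_affine nhdsWithin_le_nhds ?_ hg0 hO
      (hα c) (hβ c) (nhdsWithin_le_nhds (hH c))⟩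
    filter_upwards [self_mem_nhdsWithin] with w hw h
    rw [h] at hw
    rcases hc with hc | hc
    · exact ofReal_notMem_offInt hc.ge (by rwa [hc]) hw
    · exact ofReal_notMem_offInt (by rwa [hc]) hc.le hw

/-- This lets the upper half plane result serve the lower one. The two sides of the cut are
exchanged, hence the sign of the new jump. -/
theorem reflect (hF : CutFunction a b F f) :
    CutFunction (-b) (-a) (fun w => F (-w)) fun x => -f (-x) := by
  have hneg : ∀ (x : ℂ) (s t : Set ℂ), (∀ w ∈ s, -w ∈ t) →
      Tendsto (fun w : ℂ => -w) (𝓝[s] x) (𝓝[t] (-x)) := by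
    intro x s t hst
    refine tendsto_nhdsWithin_iff.2 ⟨continuous_neg.continuousAt.tendsto.mono_left
      nhdsWithin_le_nhds, ?_⟩
    filter_upwards [self_mem_nhdsWithin] with w hw using hst w hw
  refine ⟨?_, fun x hx => ?_, fun c hc => ?_⟩
  · exact hF.diff.comp (differentiable_neg.differentiableOn) fun w hw => neg_mem_offInt hw
  · have hx' : -x ∈ openInt a b := by
      refine ⟨?_, ?_⟩
      · rw [EReal.coe_neg]; exact EReal.lt_neg_comm.1 hx.2
      · rw [EReal.coe_neg]; exact EReal.neg_lt_comm.1 hx.1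
    obtain ⟨p, m, hp, hm, hpm⟩ := hF.jump _ hx'
    rw [Complex.ofReal_neg] at hp hm
    refine ⟨m, p, hm.comp (hneg x _ _ ?_), hp.comp (hneg x _ _ ?_), ?_⟩
    · intro w hw; simpa using hw
    · intro w hw; simpa using hw
    · rw [← hpm]; ring
  · obtain ⟨g, hg, hg0, hO⟩ := hF.endpoint (-c) (by
      rw [EReal.coe_neg]
      rcases hc with hc | hc
      · right; rw [hc, neg_neg]
      · left; rw [hc, neg_neg])
    refine ⟨g, hg, hg0, ?_⟩
    rw [Complex.ofReal_neg] at hO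
    refine (hO.comp_tendsto (hneg c (offInt (-b) (-a)) _ fun w hw => neg_mem_offInt hw)).congr
      (fun w => rfl) fun w => ?_
    simp only [Function.comp]
    rw [← norm_neg, neg_sub, sub_neg_eq_add, neg_add_eq_sub, ← norm_neg, neg_sub,
      ← norm_neg, neg_sub]

theorem tendsto_of_mem_offInt (hF : CutFunction a b F f) {x : ℝ} (hx : (x : ℂ) ∈ offInt a b)
    (s : Set ℂ) : Tendsto F (𝓝[s] (x : ℂ)) (𝓝 (F x)) :=
  (((hF.diff _ hx).differentiableAt ((isOpen_offInt a b).mem_nhds hx)).continuousAt.tendsto).mono_left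
    nhdsWithin_le_nhds

theorem upperLocal (hF : CutFunction a b F f) : UpperLocal F := by
  have key : ∀ (x : ℝ) (p : ℂ), Tendsto F (𝓝[{w : ℂ | 0 < w.im}] (x : ℂ)) (𝓝 p) →
      ∃ g : ℝ, -1 < g ∧ g ≤ 0 ∧ F =O[𝓝[{w : ℂ | 0 < w.im}] (x : ℂ)] fun w => ‖w - x‖ ^ g := by
    intro x p hp
    refine ⟨0, by norm_num, le_rfl, ?_⟩
    simpa using hp.isBigO_one ℝ
  intro x
  rcases mem_offInt_or a b x with h | h | h
  · obtain ⟨p, m, hp, -, -⟩ := hF.jump x h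
    exact key x p hp
  · obtain ⟨g, hg, hg0, hO⟩ := hF.endpoint x h
    exact ⟨g, hg, hg0, hO.mono (nhdsWithin_mono _ (upper_subset_offInt a b))⟩
  · exact key x _ (hF.tendsto_of_mem_offInt h _)

/-- The boundary values exist almost everywhere, and their difference is the jump. -/
theorem ae_boundary (hF : CutFunction a b F f) : ∃ p m : ℝ → ℂ, ∀ᵐ x : ℝ,
    Tendsto F (𝓝[{w : ℂ | 0 < w.im}] (x : ℂ)) (𝓝 (p x)) ∧
    Tendsto F (𝓝[{w : ℂ | w.im < 0}] (x : ℂ)) (𝓝 (m x)) ∧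
    p x - m x = (openInt a b).indicator f x := by
  have : ∀ x : ℝ, ∃ p m : ℂ, ¬ ((x : EReal) = a ∨ (x : EReal) = b) →
      Tendsto F (𝓝[{w : ℂ | 0 < w.im}] (x : ℂ)) (𝓝 p) ∧
      Tendsto F (𝓝[{w : ℂ | w.im < 0}] (x : ℂ)) (𝓝 m) ∧
      p - m = (openInt a b).indicator f x := by
    intro x
    by_cases hx : x ∈ openInt a b
    · obtain ⟨p, m, hp, hm, hpm⟩ := hF.jump x hx
      exact ⟨p, m, fun _ => ⟨hp, hm, by rw [Set.indicator_of_mem hx, hpm]⟩⟩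
    · refine ⟨F x, F x, fun hne => ?_⟩
      have hoff : (x : ℂ) ∈ offInt a b := by
        rcases mem_offInt_or a b x with h | h | h
        exacts [absurd h hx, absurd h hne, h]
      exact ⟨hF.tendsto_of_mem_offInt hoff _, hF.tendsto_of_mem_offInt hoff _,
        by rw [Set.indicator_of_notMem hx, sub_self]⟩
  choose p m h using this
  exact ⟨p, m, (ae_ne_endpoints a b).mono fun x hx => h x hx⟩

/-- Subtracting `F z` before dividing by `w - z` keeps the quotient analytic at `z`, while the jump
acquires the Cauchy kernel. -/
theorem dslope (hF : CutFunction a b F f) (hab : a ≤ b) {z : ℂ} (hz : z.im ≠ 0) :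
    CutFunction a b (dslope F z) fun x => ((x : ℂ) - z)⁻¹ * f x := by
  have hne : ∀ x : ℝ, (x : ℂ) ≠ z := by
    rintro x rfl
    simp at hz
  have hc : ∀ x : ℝ, ContinuousAt (fun w : ℂ => (w - z)⁻¹) x := fun x =>
    (continuousAt_id.sub continuousAt_const).inv₀ (sub_ne_zero.2 (hne x))
  refine hF.affine (β := fun w => -((w - z)⁻¹ * F z)) hc
    (fun x => ((hc x).mul continuousAt_const).neg) ?_ hab ?_
  · exact (Complex.differentiableOn_dslope
      ((isOpen_offInt a b).mem_nhds (mem_offInt_of_im_ne hz))).2 hF.diff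
  · intro x
    filter_upwards [isOpen_ne.mem_nhds (hne x)] with w hw
    rw [dslope_of_ne _ hw, slope_def_field]
    field_simp
    ring

end CutFunction

/-! ### Decay at infinity and the Cauchy representation. -/

theorem exists_bound_of_isBigO {a b : EReal} {F h : ℂ → ℂ}
    (hF : F =O[Bornology.cobounded ℂ ⊓ 𝓟 (offInt a b)] h) :
    ∃ C R : ℝ, 0 ≤ C ∧ 1 ≤ R ∧ ∀ w ∈ offInt a b, R ≤ ‖w‖ → ‖F w‖ ≤ C * ‖h w‖ := by
  obtain ⟨C, hC, hO⟩ := hF.exists_pos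
  rw [Asymptotics.isBigOWith_iff, eventually_inf_principal] at hO
  rw [← comap_norm_atTop, eventually_comap] at hO
  obtain ⟨R, hR⟩ := eventually_atTop.1 hO
  exact ⟨C, max R 1, hC.le, le_max_right _ _,
    fun w hw hRw => hR _ ((le_max_left _ _).trans hRw) w rfl hw⟩

theorem isBigO_of_bound_offInt {a b : EReal} {F h : ℂ → ℂ} {C R : ℝ}
    (hF : ∀ w ∈ offInt a b, R ≤ ‖w‖ → ‖F w‖ ≤ C * ‖h w‖) :
    F =O[Bornology.cobounded ℂ ⊓ 𝓟 (offInt a b)] h := by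
  refine Asymptotics.IsBigO.of_bound C ?_
  rw [eventually_inf_principal, ← comap_norm_atTop, eventually_comap]
  filter_upwards [eventually_ge_atTop R] with r hr w hw hwo
  exact hF w hwo (hw ▸ hr)

/-- The term `-F z / (w - z)` of the difference quotient decays only like `1/w`. Adding `F z / (w -
p)` cancels its leading part. The freedom in `p` allows this pole to be placed outside the half
plane in use; `‖p‖ = ‖z‖` only makes one radius suffice for both poles. -/
theorem dslope_add_decay {a b : EReal} {F : ℂ → ℂ}
    (hF : F =O[Bornology.cobounded ℂ ⊓ 𝓟 (offInt a b)] fun w => w⁻¹) (z p : ℂ)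
    (hp : ‖p‖ = ‖z‖) : ∃ C R : ℝ, 0 ≤ C ∧ 1 ≤ R ∧ ∀ w ∈ offInt a b, R ≤ ‖w‖ →
      ‖dslope F z w + F z * (w - p)⁻¹‖ ≤ C / ‖w‖ ^ 2 := by
  obtain ⟨C, R, hC, hR, hb⟩ := exists_bound_of_isBigO hF
  refine ⟨2 * C + 4 * (‖F z‖ * ‖p - z‖), max R (2 * ‖z‖ + 1), by positivity,
    hR.trans (le_max_left _ _), fun w hw hRw => ?_⟩
  have hw1 : R ≤ ‖w‖ := (le_max_left _ _).trans hRw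
  have hw2 : 2 * ‖z‖ + 1 ≤ ‖w‖ := (le_max_right _ _).trans hRw
  have hw0 : 0 < ‖w‖ := by linarith
  have d1 : ‖w‖ / 2 ≤ ‖w - z‖ := by
    have := norm_sub_norm_le w z
    linarith
  have d2 : ‖w‖ / 2 ≤ ‖w - p‖ := by
    have := norm_sub_norm_le w p
    rw [hp] at this
    linarith
  have n1 : w - z ≠ 0 := norm_pos_iff.1 (by linarith)
  have n2 : w - p ≠ 0 := norm_pos_iff.1 (by linarith)
  have hzw : w ≠ z := sub_ne_zero.1 n1
  have e : dslope F z w + F z * (w - p)⁻¹ =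
      F w * (w - z)⁻¹ + F z * (p - z) * ((w - p)⁻¹ * (w - z)⁻¹) := by
    rw [dslope_of_ne _ hzw, slope_def_field]
    field_simp
    ring
  have i1 : ‖(w - z)⁻¹‖ ≤ 2 / ‖w‖ := by
    rw [norm_inv, inv_le_comm₀ (by linarith) (by positivity), inv_div]; exact d1
  have i2 : ‖(w - p)⁻¹‖ ≤ 2 / ‖w‖ := by
    rw [norm_inv, inv_le_comm₀ (by linarith) (by positivity), inv_div]; exact d2
  have f1 : ‖F w‖ ≤ C / ‖w‖ := by
    simpa [div_eq_mul_inv] using hb w hw hw1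
  rw [e]
  calc ‖F w * (w - z)⁻¹ + F z * (p - z) * ((w - p)⁻¹ * (w - z)⁻¹)‖
      ≤ ‖F w‖ * ‖(w - z)⁻¹‖ + ‖F z‖ * ‖p - z‖ * (‖(w - p)⁻¹‖ * ‖(w - z)⁻¹‖) := by
        refine (norm_add_le _ _).trans ?_
        simp only [norm_mul]; exact le_rfl
    _ ≤ C / ‖w‖ * (2 / ‖w‖) + ‖F z‖ * ‖p - z‖ * (2 / ‖w‖ * (2 / ‖w‖)) := by gcongr
    _ = (2 * C + 4 * (‖F z‖ * ‖p - z‖)) / ‖w‖ ^ 2 := by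
        field_simp; ring

/-- The two correcting poles used below the cut and above it differ by this multiple of the Poisson
kernel, which is the source of the factor `2πi`. -/
theorem poisson_kernel (u : ℝ) {v : ℝ} (hv : 0 < v) :
    Integrable (fun x : ℝ => ((x : ℂ) - (u - v * Complex.I))⁻¹ - ((x : ℂ) - (u + v * Complex.I))⁻¹) ∧
    ∫ x : ℝ, (((x : ℂ) - (u - v * Complex.I))⁻¹ - ((x : ℂ) - (u + v * Complex.I))⁻¹)
      = -(2 * Real.pi * Complex.I) := by
  have e : ∀ x : ℝ, ((x : ℂ) - (u - v * Complex.I))⁻¹ - ((x : ℂ) - (u + v * Complex.I))⁻¹ =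
      (-(2 * Complex.I) / v) * (((1 + ((x - u) / v) ^ 2)⁻¹ : ℝ) : ℂ) := by
    intro x
    have n1 : (x : ℂ) - (u - v * Complex.I) ≠ 0 := by
      intro h
      have := congrArg Complex.im h
      simp at this
      exact hv.ne' this
    have n2 : (x : ℂ) - (u + v * Complex.I) ≠ 0 := by
      intro h
      have := congrArg Complex.im h
      simp at this
      exact hv.ne' this
    have n3 : (v : ℂ) ≠ 0 := by exact_mod_cast hv.ne'
    have n4 : (1 + ((x - u) / v : ℂ) ^ 2) ≠ 0 := by
      have : (1 + ((x - u) / v) ^ 2 : ℝ) ≠ 0 := by positivity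
      exact_mod_cast this
    push_cast
    have hI := Complex.I_sq
    have n5 : ((x : ℂ) - (u - v * Complex.I)) * ((x : ℂ) - (u + v * Complex.I)) =
      v ^ 2 * (1 + ((x - u) / v : ℂ) ^ 2) := by
      field_simp
      linear_combination -(v : ℂ) ^ 2 * hI
    rw [inv_sub_inv n1 n2, n5]
    field_simp
    ring
  have hI : Integrable fun x : ℝ => (1 + ((x - u) / v) ^ 2)⁻¹ :=
    ((integrable_inv_one_add_sq.comp_div hv.ne').comp_sub_right u)
  have hv2 : ∫ x : ℝ, (1 + ((x - u) / v) ^ 2)⁻¹ = v * Real.pi := by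
    rw [integral_sub_right_eq_self (fun x : ℝ => (1 + (x / v) ^ 2)⁻¹) u,
      Measure.integral_comp_div (fun x : ℝ => (1 + x ^ 2)⁻¹) v, integral_univ_inv_one_add_sq,
      abs_of_pos hv, smul_eq_mul]
  constructor
  · simp only [e]
    exact hI.ofReal.const_mul _
  · simp only [e]
    rw [integral_const_mul, integral_complex_ofReal, hv2]
    have n3 : (v : ℂ) ≠ 0 := by exact_mod_cast hv.ne'
    push_cast
    field_simp

/-- A function with jump `f` that vanishes at infinity is the Cauchy transform of `f`. -/
theorem CutFunction.eq_cauchy_of_im_ne {a b : EReal} {F : ℂ → ℂ} {f : ℝ → ℂ}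
    (hF : CutFunction a b F f) (hab : a ≤ b)
    (hdec : F =O[Bornology.cobounded ℂ ⊓ 𝓟 (offInt a b)] fun w => w⁻¹) {z : ℂ} (hz : z.im ≠ 0) :
    2 * Real.pi * Complex.I * F z = ∫ t in openInt a b, ((t : ℂ) - z)⁻¹ * f t := by
  have hG := hF.dslope hab hz
  set G := _root_.dslope F z with hGdef
  set v := |z.im| with hvdef
  have hv : 0 < v := abs_pos.2 hz
  set u := z.re with hudef
  have hp : ∀ s : ℝ, |s| = v → ‖(u : ℂ) + s * Complex.I‖ = ‖z‖ := by
    intro s hs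
    rw [← Complex.re_add_im z, Complex.norm_add_mul_I, Complex.norm_add_mul_I, ← sq_abs s,
      ← sq_abs z.im, hs]
  have hshape : ∀ (K : ℂ → ℂ) (q c : ℂ), q.im < 0 → UpperLocal K →
      DifferentiableOn ℂ K {w | 0 < w.im} →
      UpperLocal (fun w => K w + c * (w - q)⁻¹) ∧
      DifferentiableOn ℂ (fun w => K w + c * (w - q)⁻¹) {w | 0 < w.im} := by
    intro K q c hq hK hKd
    refine ⟨hK.affine (α := fun _ => 1) (β := fun w => c * (w - q)⁻¹)
      (fun x => continuousAt_const) (fun x => ?_) (fun x => ?_), ?_⟩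
    · refine continuousAt_const.mul ((continuousAt_id.sub continuousAt_const).inv₀ ?_)
      intro h
      have := congrArg Complex.im h
      simp at this
      exact hq.ne this
    · exact Eventually.of_forall fun w => by ring
    · refine hKd.add ((differentiableOn_const c).mul ((differentiableOn_id.sub
        (differentiableOn_const q)).inv fun w hw h => ?_))
      have := congrArg Complex.im h
      simp [sub_eq_zero] at this
      rw [Set.mem_ofPred_eq, this] at hw
      exact absurd hw hq.not_gt
  obtain ⟨p, m, hpm⟩ := hG.ae_boundary
  -- For the upper half plane the added pole is `u - iv`, for the lower one `u + iv`. After `w ↦ -w`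
  -- the latter becomes `-(u + iv)`, and its coefficient changes sign.
  have hupper := hshape G (u - v * Complex.I) (F z) (by simpa using hv) hG.upperLocal
    (hG.diff.mono (upper_subset_offInt a b))
  have hlower := hshape (fun w => G (-w)) (-(u + v * Complex.I)) (-F z) (by simpa using hv)
    hG.reflect.upperLocal (hG.reflect.diff.mono (upper_subset_offInt _ _))
  have hne1 : ∀ x : ℝ, (x : ℂ) - (u - v * Complex.I) ≠ 0 := by
    intro x h
    have := congrArg Complex.im h
    simp at this
    exact hv.ne' this
  have hne2 : ∀ x : ℝ, (x : ℂ) - (u + v * Complex.I) ≠ 0 := by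
    intro x h
    have := congrArg Complex.im h
    simp at this
    exact hv.ne' this
  have hup : Integrable (fun x : ℝ => p x + F z * ((x : ℂ) - (u - v * Complex.I))⁻¹) ∧
      ∫ x : ℝ, (p x + F z * ((x : ℂ) - (u - v * Complex.I))⁻¹) = 0 := by
    refine integral_upper_boundary hupper.2 ?_ hupper.1 ?_
    · obtain ⟨C, R, hC, hR, hb⟩ := dslope_add_decay hdec z (u - v * Complex.I) (by
        have := hp (-v) (by rw [abs_neg, abs_of_pos hv])
        simpa [sub_eq_add_neg] using this)
      exact ⟨C, R, hC, hR, fun w hw => hb w (upper_subset_offInt a b hw)⟩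
    · filter_upwards [hpm] with x hx
      refine hx.1.add (Tendsto.const_mul _ (Tendsto.mono_left ?_ nhdsWithin_le_nhds))
      exact ((continuousAt_id.sub continuousAt_const).inv₀ (hne1 x)).tendsto
  have hlo : Integrable (fun x : ℝ => m (-x) + F z * (((-x : ℝ) : ℂ) - (u + v * Complex.I))⁻¹) ∧
      ∫ x : ℝ, (m (-x) + F z * (((-x : ℝ) : ℂ) - (u + v * Complex.I))⁻¹) = 0 := by
    have hform : ∀ w : ℂ, G (-w) + -F z * (w - -(u + v * Complex.I))⁻¹ =
        G (-w) + F z * (-w - (u + v * Complex.I))⁻¹ := by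
      intro w
      rw [show -w - ((u : ℂ) + v * Complex.I) = -(w - -(u + v * Complex.I)) by ring, inv_neg]
      ring
    simp only [hform] at hlower
    refine integral_upper_boundary hlower.2 ?_ hlower.1 ?_
    · obtain ⟨C, R, hC, hR, hb⟩ := dslope_add_decay hdec z (u + v * Complex.I)
        (hp v (abs_of_pos hv))
      refine ⟨C, R, hC, hR, fun w hw hRw => ?_⟩
      have := hb (-w) (lower_subset_offInt a b (by simpa using hw)) (by rwa [norm_neg])
      rwa [norm_neg] at this
    · have hq := (Measure.measurePreserving_neg (volume : Measure ℝ)).quasiMeasurePreserving.ae hpm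
      filter_upwards [hq] with x hx
      have hneg : Tendsto (fun w : ℂ => -w) (𝓝[{w : ℂ | 0 < w.im}] (x : ℂ))
          (𝓝[{w : ℂ | w.im < 0}] ((-x : ℝ) : ℂ)) := by
        rw [Complex.ofReal_neg]
        refine tendsto_nhdsWithin_iff.2 ⟨continuous_neg.continuousAt.tendsto.mono_left
          nhdsWithin_le_nhds, ?_⟩
        filter_upwards [self_mem_nhdsWithin] with w hw
        simpa using hw
      have hc : ContinuousAt (fun w : ℂ => (w - (u + v * Complex.I))⁻¹) ((-x : ℝ) : ℂ) :=
        (continuousAt_id.sub continuousAt_const).inv₀ (hne2 (-x))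
      exact (hx.2.1.comp hneg).add (Tendsto.const_mul _
        ((hc.tendsto.mono_left nhdsWithin_le_nhds).comp hneg))
  have hlo' : Integrable (fun x : ℝ => m x + F z * ((x : ℂ) - (u + v * Complex.I))⁻¹) ∧
      ∫ x : ℝ, (m x + F z * ((x : ℂ) - (u + v * Complex.I))⁻¹) = 0 := by
    refine ⟨by simpa using hlo.1.comp_neg, ?_⟩
    rw [← hlo.2]
    exact (integral_neg_eq_self
      (fun x : ℝ => m x + F z * ((x : ℂ) - (u + v * Complex.I))⁻¹) volume).symm
  obtain ⟨hKi, hK⟩ := poisson_kernel u hv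
  -- Both half plane integrals vanish. In their difference `p - m` is the jump of the difference
  -- quotient, and the pole terms integrate to `-2πi F z`.
  have hdiff : ∀ᵐ x : ℝ, (p x + F z * ((x : ℂ) - (u - v * Complex.I))⁻¹) -
      (m x + F z * ((x : ℂ) - (u + v * Complex.I))⁻¹) -
      F z * (((x : ℂ) - (u - v * Complex.I))⁻¹ - ((x : ℂ) - (u + v * Complex.I))⁻¹) =
      (openInt a b).indicator (fun t => ((t : ℂ) - z)⁻¹ * f t) x := by
    filter_upwards [hpm] with x hx
    rw [← hx.2.2]
    ring
  have hsub : Integrable fun x : ℝ => (p x + F z * ((x : ℂ) - (u - v * Complex.I))⁻¹) -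
      (m x + F z * ((x : ℂ) - (u + v * Complex.I))⁻¹) := hup.1.sub hlo'.1
  rw [← integral_indicator (measurableSet_openInt a b), ← integral_congr_ae hdiff,
    integral_sub hsub (hKi.const_mul _), integral_sub hup.1 hlo'.1, hup.2, hlo'.2,
    integral_const_mul, hK]
  ring

/-! ### Cauchy transforms -/

theorem exists_dist_bound {a b : EReal} {z : ℂ} (hz : z ∈ offInt a b) : ∃ r : ℝ, 0 < r ∧
    ∀ w ∈ Metric.ball z r, ∀ t ∈ openInt a b, r ≤ ‖(t : ℂ) - w‖ := by
  obtain ⟨r, hr, hb⟩ := Metric.isOpen_iff.1 (isOpen_offInt a b) z hz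
  refine ⟨r / 2, by positivity, fun w hw t ht => ?_⟩
  by_contra! hlt
  refine ofReal_notMem_offInt ht.1.le ht.2.le (hb ?_)
  rw [Metric.mem_ball] at hw ⊢
  rw [← dist_eq_norm] at hlt
  linarith [dist_triangle (t : ℂ) w z]

theorem sub_ne_zero_of_mem {a b : EReal} {z : ℂ} (hz : z ∈ offInt a b) {t : ℝ}
    (ht : t ∈ openInt a b) : (t : ℂ) - z ≠ 0 := by
  rw [sub_ne_zero]
  rintro rfl
  exact ofReal_notMem_offInt ht.1.le ht.2.le hz

theorem integrableOn_cauchy {a b : EReal} {f : ℝ → ℂ} (hf : IntegrableOn f (openInt a b))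
    {z : ℂ} (hz : z ∈ offInt a b) (k : ℕ) :
    IntegrableOn (fun t : ℝ => (((t : ℂ) - z)⁻¹) ^ k * f t) (openInt a b) := by
  obtain ⟨r, hr, hb⟩ := exists_dist_bound hz
  refine Integrable.bdd_mul (c := (r⁻¹) ^ k) hf ?_ ?_
  · exact (((Complex.measurable_ofReal.sub_const z).inv).pow_const k).aestronglyMeasurable
  · filter_upwards [ae_restrict_mem (measurableSet_openInt a b)] with t ht
    rw [norm_pow, norm_inv]
    gcongr
    exact hb z (Metric.mem_ball_self hr) t ht

theorem hasDerivAt_cauchy {a b : EReal} {f : ℝ → ℂ} (hf : IntegrableOn f (openInt a b))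
    {z : ℂ} (hz : z ∈ offInt a b) :
    HasDerivAt (fun w => ∫ t in openInt a b, ((t : ℂ) - w)⁻¹ * f t)
      (∫ t in openInt a b, (((t : ℂ) - z)⁻¹) ^ 2 * f t) z := by
  obtain ⟨r, hr, hb⟩ := exists_dist_bound hz
  refine (hasDerivAt_integral_of_dominated_loc_of_deriv_le (s := Metric.ball z r)
    (F := fun (w : ℂ) (t : ℝ) => ((t : ℂ) - w)⁻¹ * f t)
    (F' := fun (w : ℂ) (t : ℝ) => (((t : ℂ) - w)⁻¹) ^ 2 * f t)
    (bound := fun t => (r⁻¹) ^ 2 * ‖f t‖)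
    (Metric.ball_mem_nhds z hr) ?_ ?_ ?_ ?_ ?_ ?_).2
  · refine Eventually.of_forall fun w => ?_
    exact ((Complex.measurable_ofReal.sub_const w).inv).aestronglyMeasurable.mul
      hf.aestronglyMeasurable
  · have h := integrableOn_cauchy hf hz 1
    simp only [pow_one] at h
    exact h
  · exact (integrableOn_cauchy hf hz 2).aestronglyMeasurable
  · filter_upwards [ae_restrict_mem (measurableSet_openInt a b)] with t ht w hw
    rw [norm_mul, norm_pow, norm_inv]
    gcongr
    exact hb w hw t ht
  · exact hf.norm.const_mul _
  · filter_upwards [ae_restrict_mem (measurableSet_openInt a b)] with t ht w hw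
    have hne : (t : ℂ) - w ≠ 0 := norm_pos_iff.1 (hr.trans_le (hb w hw t ht))
    have h := (((hasDerivAt_id w).const_sub (t : ℂ)).inv hne).mul_const (f t)
    refine h.congr_deriv ?_
    simp only [id]
    field_simp

/-- A real point off the cut is approached along `z + iε`. Integrability of `f` makes the right-hand
side continuous there. -/
theorem CutFunction.eq_cauchy {a b : EReal} {F : ℂ → ℂ} {f : ℝ → ℂ}
    (hF : CutFunction a b F f) (hab : a ≤ b) (hf : IntegrableOn f (openInt a b))
    (hdec : F =O[Bornology.cobounded ℂ ⊓ 𝓟 (offInt a b)] fun w => w⁻¹) {z : ℂ}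
    (hz : z ∈ offInt a b) :
    2 * Real.pi * Complex.I * F z = ∫ t in openInt a b, ((t : ℂ) - z)⁻¹ * f t := by
  have hpath : Tendsto (fun ε : ℝ => z + ε * Complex.I) (𝓝[≠] 0) (𝓝 z) := by
    have : Continuous fun ε : ℝ => z + ε * Complex.I := by fun_prop
    exact (this.tendsto' 0 z (by simp)).mono_left nhdsWithin_le_nhds
  have h1 : ContinuousAt (fun w => 2 * Real.pi * Complex.I * F w) z :=
    continuousAt_const.mul
      ((hF.diff z hz).differentiableAt ((isOpen_offInt a b).mem_nhds hz)).continuousAt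
  have h2 := (hasDerivAt_cauchy hf hz).continuousAt
  by_cases hzi : z.im = 0
  · refine tendsto_nhds_unique (h1.tendsto.comp hpath) ((h2.tendsto.comp hpath).congr' ?_)
    filter_upwards [self_mem_nhdsWithin] with ε hε
    exact (hF.eq_cauchy_of_im_ne hab hdec (by simpa [hzi] using hε)).symm
  · exact hF.eq_cauchy_of_im_ne hab hdec hzi

/-- A function without jump and of polynomial growth is a polynomial. -/
theorem CutFunction.exists_polynomial {a b : EReal} (hab : a ≤ b) (k : ℕ) :
    ∀ {F : ℂ → ℂ}, CutFunction a b F 0 →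
      (F =O[Bornology.cobounded ℂ ⊓ 𝓟 (offInt a b)] fun w => w ^ k * w⁻¹) →
      ∃ p : ℂ[X], p.degree < k ∧ ∀ w ∈ offInt a b, F w = p.eval w := by
  induction k with
  | zero =>
    intro F hF hO
    refine ⟨0, by simp, fun w hw => ?_⟩
    have h := hF.eq_cauchy hab (integrable_zero _ _ _) (by simpa using hO) hw
    simpa [Real.pi_ne_zero, Complex.I_ne_zero] using h
  | succ k ih =>
    intro F hF hO
    -- The point `i` lies off every real cut. The difference quotient at `i` again has no jump and
    -- grows one order more slowly.
    have hI : Complex.I ∈ offInt a b := mem_offInt_of_im_ne (by simp)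
    have hG : CutFunction a b (_root_.dslope F Complex.I) 0 := by
      convert! hF.dslope hab (z := Complex.I) (by simp) using 1
      ext x
      simp
    obtain ⟨C, R, hC, hR, hb⟩ := exists_bound_of_isBigO hO
    obtain ⟨p, hp, hpe⟩ := ih hG (by
      refine isBigO_of_bound_offInt (C := 2 * (C + ‖F Complex.I‖)) (R := max R 2)
        fun w hw hRw => ?_
      have hw1 : R ≤ ‖w‖ := (le_max_left _ _).trans hRw
      have hw2 : 2 ≤ ‖w‖ := (le_max_right _ _).trans hRw
      have hw0 : 0 < ‖w‖ := by linarith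
      have d1 : ‖w‖ / 2 ≤ ‖w - Complex.I‖ := by
        have := norm_sub_norm_le w Complex.I
        rw [Complex.norm_I] at this
        linarith
      have n1 : w - Complex.I ≠ 0 := norm_pos_iff.1 (by linarith)
      have w0 : w ≠ 0 := norm_pos_iff.1 hw0
      have hFw : ‖F w‖ ≤ C * ‖w‖ ^ k := by
        have := hb w hw hw1
        rwa [pow_succ, mul_inv_cancel_right₀ w0, norm_pow] at this
      have hFI : ‖F Complex.I‖ ≤ ‖F Complex.I‖ * ‖w‖ ^ k :=
        le_mul_of_one_le_right (norm_nonneg _) (one_le_pow₀ (by linarith))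
      rw [dslope_of_ne _ (sub_ne_zero.1 n1), slope_def_field, norm_div,
        norm_mul, norm_pow, norm_inv]
      calc ‖F w - F Complex.I‖ / ‖w - Complex.I‖
          ≤ ((C + ‖F Complex.I‖) * ‖w‖ ^ k) / (‖w‖ / 2) := by
            gcongr
            refine (norm_sub_le _ _).trans ?_
            linarith
        _ = 2 * (C + ‖F Complex.I‖) * (‖w‖ ^ k * ‖w‖⁻¹) := by field_simp)
    refine ⟨Polynomial.C (F Complex.I) + (X - Polynomial.C Complex.I) * p, ?_, fun w hw => ?_⟩
    · rw [degree_lt_iff_coeff_zero] at hp ⊢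
      intro m hm
      obtain ⟨l, rfl⟩ : ∃ l, m = l + 1 := ⟨m - 1, by omega⟩
      rw [coeff_add, coeff_C_succ, sub_mul, coeff_sub, coeff_X_mul, coeff_C_mul,
        hp l (by omega), hp (l + 1) (by omega)]
      simp
    · rw [eval_add, eval_mul, eval_sub, eval_C, eval_X, eval_C, ← hpe w hw]
      by_cases h : w = Complex.I
      · rw [h]; simp
      · rw [dslope_of_ne _ h, slope_def_field]
        have := sub_ne_zero.2 h
        field_simp
        ring

theorem isBigO_pow_mul_of_lt {a b : EReal} {F : ℂ → ℂ} {A : ℂ} {n k : ℕ} (hk : k < n)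
    (hO : (fun w => w ^ n * F w - A) =O[Bornology.cobounded ℂ ⊓ 𝓟 (offInt a b)] fun w => w⁻¹) :
    (fun w => w ^ k * F w) =O[Bornology.cobounded ℂ ⊓ 𝓟 (offInt a b)] fun w => w⁻¹ := by
  obtain ⟨C, R, hC, hR, hb⟩ := exists_bound_of_isBigO hO
  refine isBigO_of_bound_offInt (C := C + ‖A‖) (R := R) fun w hw hRw => ?_
  have hw1 : 1 ≤ ‖w‖ := hR.trans hRw
  have hw0 : 0 < ‖w‖ := by linarith
  have w0 : w ≠ 0 := norm_pos_iff.1 hw0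
  obtain ⟨l, rfl⟩ : ∃ l, n = k + 1 + l := ⟨n - (k + 1), by omega⟩
  have h1 : ‖w ^ (k + 1 + l) * F w‖ ≤ C + ‖A‖ := by
    have h2 := hb w hw hRw
    have h3 : C * ‖w⁻¹‖ ≤ C := by
      rw [norm_inv]
      exact mul_le_of_le_one_right hC (inv_le_one_of_one_le₀ hw1)
    have h4 := norm_le_norm_sub_add (w ^ (k + 1 + l) * F w) A
    linarith
  have h2 : ‖w‖ * ‖w ^ k * F w‖ ≤ C + ‖A‖ := by
    refine le_trans ?_ h1
    have e : w ^ (k + 1 + l) * F w = w ^ l * (w * (w ^ k * F w)) := by ring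
    rw [← norm_mul, e, norm_mul (w ^ l), norm_pow]
    exact le_mul_of_one_le_left (by positivity) (one_le_pow₀ hw1)
  rw [norm_inv, ← div_eq_mul_inv, le_div_iff₀ hw0]
  linarith

theorem CutFunction.pow_mul_sub {a b : EReal} {F : ℂ → ℂ} {f : ℝ → ℂ}
    (hF : CutFunction a b F f) (hab : a ≤ b) (k : ℕ) (A : ℂ) :
    CutFunction a b (fun w => w ^ k * F w - A) fun x => (x : ℂ) ^ k * f x := by
  refine hF.affine (α := fun w => w ^ k) (β := fun _ => -A) (fun x => by fun_prop)
    (fun x => by fun_prop) ?_ hab fun x => Eventually.of_forall fun w => by ring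
  exact ((differentiable_pow k).differentiableOn.mul hF.diff).sub (differentiableOn_const A)

/-- The moments of the jump are read off from the behavior at infinity. -/
theorem CutFunction.moment {a b : EReal} {F : ℂ → ℂ} {f : ℝ → ℂ}
    (hF : CutFunction a b F f) (hab : a ≤ b)
    (hf : ∀ k : ℕ, IntegrableOn (fun t : ℝ => (t : ℂ) ^ k * f t) (openInt a b)) {k : ℕ} {A : ℂ}
    (h0 : (fun w => w ^ k * F w) =O[Bornology.cobounded ℂ ⊓ 𝓟 (offInt a b)] fun w => w⁻¹)
    (h1 : (fun w => w ^ (k + 1) * F w - A) =O[Bornology.cobounded ℂ ⊓ 𝓟 (offInt a b)]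
      fun w => w⁻¹) :
    ∫ t in openInt a b, (t : ℂ) ^ k * f t = -(2 * Real.pi * Complex.I) * A := by
  have hI : Complex.I ∈ offInt a b := mem_offInt_of_im_ne (by simp)
  have e0 := (hF.pow_mul_sub hab k 0).eq_cauchy hab (hf k) (by simpa using h0) hI
  have e1 := (hF.pow_mul_sub hab (k + 1) A).eq_cauchy hab (hf (k + 1)) h1 hI
  have i0 := integrableOn_cauchy (hf k) hI 1
  have i1 := integrableOn_cauchy (hf (k + 1)) hI 1
  simp only [pow_one] at i0 i1
  -- From `t ^ k = (t ^ (k + 1) - i t ^ k) / (t - i)` the moment is a combination of two Cauchy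
  -- integrals at `i`. The values of `F` at `i` cancel and only `A` remains.
  have hE : ∫ t in openInt a b, (t : ℂ) ^ k * f t =
      ∫ t in openInt a b, (((t : ℂ) - Complex.I)⁻¹ * ((t : ℂ) ^ (k + 1) * f t) -
        Complex.I * (((t : ℂ) - Complex.I)⁻¹ * ((t : ℂ) ^ k * f t))) := by
    refine setIntegral_congr_fun (measurableSet_openInt a b) fun t ht => ?_
    have := sub_ne_zero_of_mem hI ht
    field_simp
    ring
  rw [hE, integral_sub i1 (i0.const_mul _), integral_const_mul, ← e0, ← e1]
  ring

variable {N : ℕ}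

/-! ### Values of matrix polynomials -/

theorem val_add (P Q : (Matrix (Fin N) (Fin N) ℂ)[X]) (z : ℂ) :
    val (P + Q) z = val P z + val Q z := by simp [val]

theorem val_zero (z : ℂ) : val (0 : (Matrix (Fin N) (Fin N) ℂ)[X]) z = 0 := by simp [val]

theorem val_C (A : Matrix (Fin N) (Fin N) ℂ) (z : ℂ) : val (C A) z = A := by simp [val]

theorem val_one (z : ℂ) : val (1 : (Matrix (Fin N) (Fin N) ℂ)[X]) z = 1 := by simp [val]

theorem val_C_mul (A : Matrix (Fin N) (Fin N) ℂ) (P : (Matrix (Fin N) (Fin N) ℂ)[X]) (z : ℂ) :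
    val (C A * P) z = A * val P z := by simp [val, eval_C_mul]

theorem val_mul_X (P : (Matrix (Fin N) (Fin N) ℂ)[X]) (z : ℂ) : val (P * X) z = z • val P z := by
  rw [val, eval_mul_X, ← Algebra.commutes, ← Algebra.smul_def, val]

theorem val_monomial (k : ℕ) (A : Matrix (Fin N) (Fin N) ℂ) (z : ℂ) :
    val (monomial k A) z = z ^ k • A := by
  rw [val, eval_monomial, ← map_pow, ← Algebra.commutes, ← Algebra.smul_def]

/-- Under a kernel `1 / (t - w)` this replaces `P t` by the constant `P w`, at the cost of a lower
degree polynomial that orthogonality can remove. The clause on coefficients says that `R` inherits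
the leading coefficient of `P`. -/
theorem exists_divided_difference (w : ℂ) (d : ℕ) : ∀ P : (Matrix (Fin N) (Fin N) ℂ)[X],
    P.degree < d → ∃ R : (Matrix (Fin N) (Fin N) ℂ)[X], R.degree < (d - 1 : ℕ) ∧
      (∀ m, m + 2 = d → R.coeff m = P.coeff (m + 1)) ∧
      ∀ t, val P t = val P w + (t - w) • val R t := by
  induction d with
  | zero =>
    intro P hP
    have : P = 0 := by
      ext1 m
      exact (degree_lt_iff_coeff_zero _ _).1 hP m (Nat.zero_le _)
    subst this
    exact ⟨0, by simp, by simp, by simp [val_zero]⟩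
  | succ d ih =>
    intro P hP
    have hQ : P.divX.degree < d := by
      rw [degree_lt_iff_coeff_zero] at hP ⊢
      intro m hm
      rw [coeff_divX]
      exact hP _ (by omega)
    obtain ⟨R, hR, -, hRe⟩ := ih P.divX hQ
    have hPe : ∀ t, val P t = t • val P.divX t + P.coeff 0 := by
      intro t
      conv_lhs => rw [← divX_mul_X_add P]
      rw [val_add, val_mul_X, val_C]
    rw [degree_lt_iff_coeff_zero] at hR hQ
    -- With `Q = P.divX`: `t Q(t) - w Q(w) = (t - w) Q(t) + w (Q(t) - Q(w))`.
    refine ⟨P.divX + w • R, ?_, ?_, ?_⟩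
    · rw [degree_lt_iff_coeff_zero]
      intro m hm
      rw [coeff_add, coeff_smul, hQ m (by omega), hR m (by omega)]
      simp
    · intro m hm
      rw [coeff_add, coeff_smul, coeff_divX, hR m (by omega)]
      simp
    · intro t
      have hs : val (w • R) t = w • val R t := by
        simp only [val, eval_smul]
      rw [hPe t, hPe w, val_add, hs, hRe t]
      module

/-- Entrywise derivative along the complex plane or the real line. -/
def MatDeriv {𝕜 : Type*} [NontriviallyNormedField 𝕜] [NormedAlgebra 𝕜 ℂ]
    {l m : Type*} (F : 𝕜 → Matrix l m ℂ) (F' : Matrix l m ℂ) (t : 𝕜) : Prop :=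
  ∀ i j, HasDerivAt (fun s => F s i j) (F' i j) t

namespace MatDeriv

variable {𝕜 : Type*} [NontriviallyNormedField 𝕜] [NormedAlgebra 𝕜 ℂ] {l m o : Type*}
  {F : 𝕜 → Matrix l m ℂ} {F' : Matrix l m ℂ} {t : 𝕜}

theorem mul [Fintype m] {G : 𝕜 → Matrix m o ℂ} {G' : Matrix m o ℂ} (hF : MatDeriv F F' t)
    (hG : MatDeriv G G' t) : MatDeriv (fun s => F s * G s) (F' * G t + F t * G') t := by
  intro i j
  simp only [Matrix.mul_apply, Matrix.add_apply, ← Finset.sum_add_distrib]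
  exact HasDerivAt.fun_sum fun k _ => (hF i k).mul (hG k j)

theorem smul {c : 𝕜 → ℂ} {c' : ℂ} (hc : HasDerivAt c c' t) (hF : MatDeriv F F' t) :
    MatDeriv (fun s => c s • F s) (c' • F t + c t • F') t :=
  fun i j => hc.mul (hF i j)

theorem add {G : 𝕜 → Matrix l m ℂ} {G' : Matrix l m ℂ} (hF : MatDeriv F F' t)
    (hG : MatDeriv G G' t) : MatDeriv (fun s => F s + G s) (F' + G') t :=
  fun i j => (hF i j).add (hG i j)

theorem const (A : Matrix l m ℂ) : MatDeriv (fun _ : 𝕜 => A) 0 t :=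
  fun _ _ => hasDerivAt_const _ _

end MatDeriv

theorem matDeriv_val (P : (Matrix (Fin N) (Fin N) ℂ)[X]) (z : ℂ) :
    MatDeriv (val P) (val (derivative P) z) z := by
  induction P using Polynomial.induction_on' with
  | add p q hp hq =>
    have := hp.add hq
    rw [derivative_add, val_add]
    convert this using 2
    rw [val_add]
  | monomial k A =>
    have := MatDeriv.smul (hasDerivAt_pow k z) (MatDeriv.const (𝕜 := ℂ) (t := z) A)
    rw [derivative_monomial, val_monomial]
    have e : val (monomial k A) = fun s => s ^ k • A := funext fun s => val_monomial k A s
    rw [e]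
    convert this using 1
    rw [smul_zero, add_zero, mul_comm, mul_smul]
    congr 1
    rw [← nsmul_eq_mul', ← Nat.cast_smul_eq_nsmul ℂ]

theorem matDeriv_val_ofReal (P : (Matrix (Fin N) (Fin N) ℂ)[X]) (t : ℝ) :
    MatDeriv (fun s : ℝ => val P (s : ℂ)) (val (derivative P) t) t :=
  fun i j => (matDeriv_val P t i j).comp_ofReal

theorem matDeriv_val_star (P : (Matrix (Fin N) (Fin N) ℂ)[X]) (t : ℝ) :
    MatDeriv (fun s : ℝ => (val P (s : ℂ))ᴴ) (val (derivative P) t)ᴴ t :=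
  fun i j => (matDeriv_val_ofReal P t j i).star

/-- The divided difference at the base point is the derivative. -/
theorem divided_difference_self {P R : (Matrix (Fin N) (Fin N) ℂ)[X]} {w : ℂ}
    (h : ∀ t, val P t = val P w + (t - w) • val R t) : val R w = val (derivative P) w := by
  ext i j
  refine HasDerivAt.unique ?_ (matDeriv_val P w i j)
  have h1 := (MatDeriv.const (𝕜 := ℂ) (t := w) (val P w)).add
    (MatDeriv.smul ((hasDerivAt_id w).sub_const w) (matDeriv_val R w))
  have h2 := h1 i j
  simp only [id, sub_self, zero_smul, add_zero, zero_add, one_smul] at h2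
  refine h2.congr_of_eventuallyEq (Eventually.of_forall fun t => ?_)
  change val P t i j = _
  rw [h t]

/-! ### Entrywise integrals -/

/-- Entrywise integrability on `(a, b)`. -/
def MatIntegrable (a b : EReal) (F : ℝ → Matrix (Fin N) (Fin N) ℂ) : Prop :=
  ∀ i j, IntegrableOn (fun t => F t i j) (openInt a b)

section matInt

variable {a b : EReal} {F G : ℝ → Matrix (Fin N) (Fin N) ℂ}

theorem MatIntegrable.add (hF : MatIntegrable a b F) (hG : MatIntegrable a b G) :
    MatIntegrable a b fun t => F t + G t := fun i j => (hF i j).add (hG i j)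

theorem MatIntegrable.const_mul (A : Matrix (Fin N) (Fin N) ℂ) (hF : MatIntegrable a b F) :
    MatIntegrable a b fun t => A * F t := fun i j => by
  simp only [Matrix.mul_apply]
  exact integrable_finsetSum _ fun k _ => (hF k j).const_mul _

theorem MatIntegrable.mul_const (hF : MatIntegrable a b F) (A : Matrix (Fin N) (Fin N) ℂ) :
    MatIntegrable a b fun t => F t * A := fun i j => by
  simp only [Matrix.mul_apply]
  exact integrable_finsetSum _ fun k _ => (hF i k).mul_const _

theorem MatIntegrable.const_smul (c : ℂ) (hF : MatIntegrable a b F) :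
    MatIntegrable a b fun t => c • F t := fun i j => (hF i j).const_mul c

theorem MatIntegrable.congr (hF : MatIntegrable a b F) (h : ∀ t ∈ openInt a b, F t = G t) :
    MatIntegrable a b G := fun i j =>
  (hF i j).congr_fun (fun t ht => by simp only [h t ht]) (measurableSet_openInt a b)

theorem matInt_congr (h : ∀ t ∈ openInt a b, F t = G t) : matInt a b F = matInt a b G := by
  ext i j
  exact setIntegral_congr_fun (measurableSet_openInt a b) fun t ht => by simp only [h t ht]

theorem matInt_add (hF : MatIntegrable a b F) (hG : MatIntegrable a b G) :
    matInt a b (fun t => F t + G t) = matInt a b F + matInt a b G := by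
  ext i j
  exact integral_add (hF i j) (hG i j)

theorem matInt_smul (c : ℂ) (F : ℝ → Matrix (Fin N) (Fin N) ℂ) :
    matInt a b (fun t => c • F t) = c • matInt a b F := by
  ext i j
  exact integral_const_mul c _

theorem matInt_const_mul (A : Matrix (Fin N) (Fin N) ℂ) (hF : MatIntegrable a b F) :
    matInt a b (fun t => A * F t) = A * matInt a b F := by
  ext i j
  simp only [matInt, Matrix.mul_apply, of_apply]
  rw [integral_finsetSum _ fun k _ => (hF k j).const_mul _]
  simp only [integral_const_mul]

theorem matInt_mul_const (hF : MatIntegrable a b F) (A : Matrix (Fin N) (Fin N) ℂ) :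
    matInt a b (fun t => F t * A) = matInt a b F * A := by
  ext i j
  simp only [matInt, Matrix.mul_apply, of_apply]
  rw [integral_finsetSum _ fun k _ => (hF i k).mul_const _]
  simp only [integral_mul_const]

theorem matInt_conjTranspose (F : ℝ → Matrix (Fin N) (Fin N) ℂ) :
    matInt a b (fun t => (F t)ᴴ) = (matInt a b F)ᴴ := by
  ext i j
  exact integral_conj

end matInt

/-! ### The fundamental theorem of calculus on `(a, b)` -/

theorem eventually_toLeftEnd {a : EReal} {x : ℝ} (h : a < x) :
    ∀ᶠ s : ℝ in toLeftEnd a, a < (s : EReal) ∧ s < x := by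
  have : ∀ᶠ y in 𝓝[>] a, y ∈ Set.Ioo a (x : EReal) := Ioo_mem_nhdsGT h
  exact (this.comap _).mono fun s hs => ⟨hs.1, EReal.coe_lt_coe_iff.1 hs.2⟩

theorem eventually_toRightEnd {b : EReal} {x : ℝ} (h : (x : EReal) < b) :
    ∀ᶠ s : ℝ in toRightEnd b, x < s ∧ (s : EReal) < b := by
  have : ∀ᶠ y in 𝓝[<] b, y ∈ Set.Ioo (x : EReal) b := Ioo_mem_nhdsLT h
  exact (this.comap _).mono fun s hs => ⟨EReal.coe_lt_coe_iff.1 hs.1, hs.2⟩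

theorem toLeftEnd_neBot {a b : EReal} (hab : a < b) : (toLeftEnd a).NeBot := by
  rw [toLeftEnd, comap_neBot_iff]
  intro s hs
  obtain ⟨u, hu, hus⟩ := (mem_nhdsGT_iff_exists_Ioo_subset' hab).1 hs
  obtain ⟨x, h1, h2⟩ := EReal.lt_iff_exists_real_btwn.1 hu
  exact ⟨x, hus ⟨h1, h2⟩⟩

theorem toRightEnd_neBot {a b : EReal} (hab : a < b) : (toRightEnd b).NeBot := by
  rw [toRightEnd, comap_neBot_iff]
  intro s hs
  obtain ⟨u, hu, hus⟩ := (mem_nhdsLT_iff_exists_Ioo_subset' hab).1 hs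
  obtain ⟨x, h1, h2⟩ := EReal.lt_iff_exists_real_btwn.1 hu
  exact ⟨x, hus ⟨h1, h2⟩⟩

/-- The interval is exhausted by compact ones whose endpoints move independently along the two end
filters, so finite and infinite endpoints are treated alike. -/
theorem integral_openInt_of_hasDerivAt {a b : EReal} (hab : a < b) {f f' : ℝ → ℂ}
    (hd : ∀ t ∈ openInt a b, HasDerivAt f (f' t) t) (hi : IntegrableOn f' (openInt a b))
    {L R : ℂ} (hL : Tendsto f (toLeftEnd a) (𝓝 L)) (hR : Tendsto f (toRightEnd b) (𝓝 R)) :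
    ∫ t in openInt a b, f' t = R - L := by
  have := toLeftEnd_neBot hab
  have := toRightEnd_neBot hab
  have : (toLeftEnd a).IsCountablyGenerated := by unfold toLeftEnd; infer_instance
  have : (toRightEnd b).IsCountablyGenerated := by unfold toRightEnd; infer_instance
  have hcov : AECover (volume.restrict (openInt a b)) (toLeftEnd a ×ˢ toRightEnd b)
      fun p : ℝ × ℝ => Set.Ioc p.1 p.2 := by
    refine ⟨?_, fun p => measurableSet_Ioc⟩
    filter_upwards [ae_restrict_mem (measurableSet_openInt a b)] with x hx
    filter_upwards [(eventually_toLeftEnd hx.1).prod_mk (eventually_toRightEnd hx.2)] with p hp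
    exact ⟨hp.1.2, hp.2.1.le⟩
  refine hcov.integral_eq_of_tendsto _ hi ?_
  obtain ⟨x, hx1, hx2⟩ := EReal.lt_iff_exists_real_btwn.1 hab
  refine ((hR.comp tendsto_snd).sub (hL.comp tendsto_fst)).congr' ?_
  filter_upwards [(eventually_toLeftEnd hx1).prod_mk (eventually_toRightEnd hx2)] with p hp
  have hle : p.1 ≤ p.2 := (hp.1.2.trans hp.2.1).le
  have hsub : Set.Icc p.1 p.2 ⊆ openInt a b := fun t ht =>
    ⟨hp.1.1.trans_le (EReal.coe_le_coe_iff.2 ht.1), (EReal.coe_le_coe_iff.2 ht.2).trans_lt hp.2.2⟩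
  rw [Measure.restrict_restrict measurableSet_Ioc,
    Set.inter_eq_left.2 (Set.Ioc_subset_Icc_self.trans hsub), ← intervalIntegral.integral_of_le hle]
  refine (intervalIntegral.integral_eq_sub_of_hasDerivAt (fun t ht => hd t (hsub ?_)) ?_).symm
  · rwa [Set.uIcc_of_le hle] at ht
  · rw [intervalIntegrable_iff_integrableOn_Ioc_of_le hle]
    exact hi.mono_set (Set.Ioc_subset_Icc_self.trans hsub)

/-! ### Integral transforms of the weight -/

section kern

variable {a b : EReal} {ga gb : ℝ} {W : ℝ → Matrix (Fin N) (Fin N) ℝ}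

/-- Additivity in `R` and in `S` reduces the claim to monomials, that is, to the moments. -/
theorem IsWeight.matIntegrable_val (hW : IsWeight a b ga gb W)
    (R S : (Matrix (Fin N) (Fin N) ℂ)[X]) :
    MatIntegrable a b fun t => val R t * cW W t * (val S t)ᴴ := by
  induction R using Polynomial.induction_on' with
  | add p q hp hq =>
    refine (hp.add hq).congr fun t _ => ?_
    rw [val_add, add_mul, add_mul]
  | monomial k A =>
    induction S using Polynomial.induction_on' with
    | add p q hp hq =>
      refine (hp.add hq).congr fun t _ => ?_
      rw [val_add, conjTranspose_add, mul_add]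
    | monomial l B =>
      have h0 : MatIntegrable a b fun t => ((t : ℂ) ^ (k + l)) • cW W t := by
        intro i j
        have h1 := hW.moments (k + l) i j
        -- The zeroth moment supplies measurability of the entries.
        have hm : AEStronglyMeasurable (fun x => W x i j) (volume.restrict (openInt a b)) := by
          have := (hW.moments 0 i j).aestronglyMeasurable
          simpa using this
        have h2 : IntegrableOn (fun t : ℝ => t ^ (k + l) * W t i j) (openInt a b) := by
          refine Integrable.congr' h1 ?_ (Eventually.of_forall fun t => ?_)
          · exact (measurable_id.pow_const (k + l)).aestronglyMeasurable.mul hm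
          · simp
        refine h2.ofReal.congr (Eventually.of_forall fun t => ?_)
        simp [cW]
      refine ((h0.const_mul A).mul_const Bᴴ).congr fun t _ => ?_
      rw [val_monomial, val_monomial, conjTranspose_smul, star_pow,
        show star (t : ℂ) = t from Complex.conj_ofReal t]
      simp only [smul_mul_assoc, mul_smul_comm, smul_smul, pow_add]
      rw [mul_comm]

/-- The transform `∫ R(t) W(t) S(t)^* / (t - z) ^ k dt`. -/
noncomputable def kern (a b : EReal) (W : ℝ → Matrix (Fin N) (Fin N) ℝ) (k : ℕ)
    (R S : (Matrix (Fin N) (Fin N) ℂ)[X]) (z : ℂ) : Matrix (Fin N) (Fin N) ℂ :=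
  matInt a b fun t => (((t : ℂ) - z)⁻¹) ^ k • (val R t * cW W t * (val S t)ᴴ)

theorem kern_zero (R S : (Matrix (Fin N) (Fin N) ℂ)[X]) (z : ℂ) :
    kern a b W 0 R S z = innerW a b W R S := by
  simp only [kern, pow_zero, one_smul, innerW]

theorem MatIntegrable.cauchy {F : ℝ → Matrix (Fin N) (Fin N) ℂ} (hF : MatIntegrable a b F)
    {z : ℂ} (hz : z ∈ offInt a b) (k : ℕ) :
    MatIntegrable a b fun t => (((t : ℂ) - z)⁻¹) ^ k • F t :=
  fun i j => integrableOn_cauchy (hF i j) hz k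

theorem IsWeight.matIntegrable_kern (hW : IsWeight a b ga gb W)
    (R S : (Matrix (Fin N) (Fin N) ℂ)[X]) {z : ℂ} (hz : z ∈ offInt a b) (k : ℕ) :
    MatIntegrable a b fun t => (((t : ℂ) - z)⁻¹) ^ k • (val R t * cW W t * (val S t)ᴴ) :=
  (hW.matIntegrable_val R S).cauchy hz k

theorem IsWeight.cW_conjTranspose (hW : IsWeight a b ga gb W) {t : ℝ} (ht : t ∈ openInt a b) :
    (cW W t)ᴴ = cW W t := by
  ext i j
  have h := congrFun (congrFun (hW.posDef t ht).isHermitian i) j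
  simp only [conjTranspose_apply, star_trivial] at h
  simp [cW, h]

theorem IsWeight.kern_conjTranspose (hW : IsWeight a b ga gb W) (k : ℕ)
    (R S : (Matrix (Fin N) (Fin N) ℂ)[X]) (z : ℂ) :
    (kern a b W k R S ((starRingEnd ℂ) z))ᴴ = kern a b W k S R z := by
  rw [kern, ← matInt_conjTranspose, kern]
  refine matInt_congr fun t ht => ?_
  rw [conjTranspose_smul, conjTranspose_mul, conjTranspose_mul, conjTranspose_conjTranspose,
    hW.cW_conjTranspose ht, mul_assoc]
  simp

theorem IsWeight.innerW_conjTranspose (hW : IsWeight a b ga gb W)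
    (R S : (Matrix (Fin N) (Fin N) ℂ)[X]) : (innerW a b W R S)ᴴ = innerW a b W S R := by
  rw [← kern_zero R S ((starRingEnd ℂ) 0), hW.kern_conjTranspose, kern_zero]

/-- `S' ` is a divided difference at `conj z`; after taking adjoints its factor is `t - z`, which
lowers the power of the kernel by one. -/
theorem IsWeight.kern_reduce_right (hW : IsWeight a b ga gb W)
    (R : (Matrix (Fin N) (Fin N) ℂ)[X]) {S S' : (Matrix (Fin N) (Fin N) ℂ)[X]} {z : ℂ}
    (hz : z ∈ offInt a b) (k : ℕ)
    (h : ∀ t, val S t = val S ((starRingEnd ℂ) z) + (t - (starRingEnd ℂ) z) • val S' t) :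
    kern a b W (k + 1) R S z =
      kern a b W (k + 1) R 1 z * (val S ((starRingEnd ℂ) z))ᴴ + kern a b W k R S' z := by
  have i1 := hW.matIntegrable_kern R 1 hz (k + 1)
  have i2 := hW.matIntegrable_kern R S' hz k
  rw [kern, kern, kern, ← matInt_mul_const i1, ← matInt_add (i1.mul_const _) i2]
  refine matInt_congr fun t ht => ?_
  have hne := sub_ne_zero_of_mem hz ht
  have hs : star ((t : ℂ) - (starRingEnd ℂ) z) = t - z := by simp
  rw [h t, conjTranspose_add, conjTranspose_smul, hs, val_one, conjTranspose_one, mul_one,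
    mul_add, mul_smul_comm, smul_add, smul_smul, pow_succ, inv_mul_cancel_right₀ hne,
    smul_mul_assoc]

theorem IsWeight.kern_reduce_left (hW : IsWeight a b ga gb W)
    {R R' : (Matrix (Fin N) (Fin N) ℂ)[X]} (S : (Matrix (Fin N) (Fin N) ℂ)[X]) {z : ℂ}
    (hz : z ∈ offInt a b) (k : ℕ) (h : ∀ t, val R t = val R z + (t - z) • val R' t) :
    kern a b W (k + 1) R S z =
      val R z * kern a b W (k + 1) 1 S z + kern a b W k R' S z := by
  have i1 := hW.matIntegrable_kern 1 S hz (k + 1)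
  have i2 := hW.matIntegrable_kern R' S hz k
  rw [kern, kern, kern, ← matInt_const_mul _ i1, ← matInt_add (i1.const_mul _) i2]
  refine matInt_congr fun t ht => ?_
  have hne := sub_ne_zero_of_mem hz ht
  rw [h t, val_one, one_mul, add_mul, add_mul, smul_mul_assoc, smul_mul_assoc, smul_add,
    smul_smul, pow_succ, inv_mul_cancel_right₀ hne, mul_smul_comm, mul_assoc]

theorem IsWeight.matDeriv_kern (hW : IsWeight a b ga gb W)
    (R : (Matrix (Fin N) (Fin N) ℂ)[X]) {z : ℂ} (hz : z ∈ offInt a b) :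
    MatDeriv (kern a b W 1 R 1) (kern a b W 2 R 1 z) z := by
  intro i j
  have h := hasDerivAt_cauchy ((hW.matIntegrable_val R 1) i j) hz
  simp only [kern, matInt, of_apply, pow_one]
  exact h

theorem IsWeight.matDeriv_cW (hW : IsWeight a b ga gb W) {t : ℝ} (ht : t ∈ openInt a b) :
    MatDeriv (cW W) (cW (derivW W) t) t :=
  fun i j => (hW.differentiable t ht i j).hasDerivAt.ofReal_comp

theorem IsWeight.matDeriv_boundaryFun (hW : IsWeight a b ga gb W)
    (R S : (Matrix (Fin N) (Fin N) ℂ)[X]) {z : ℂ} (hz : z ∈ offInt a b) {t : ℝ}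
    (ht : t ∈ openInt a b) :
    MatDeriv (boundaryFun W R S z)
      (integrand W R S z t + ((((t : ℂ) - z)⁻¹) ^ 1 • (val (derivative R) t * cW W t * (val S t)ᴴ) +
        ((((t : ℂ) - z)⁻¹) ^ 1 • (val R t * cW W t * (val (derivative S) t)ᴴ) +
        (-1 : ℂ) • ((((t : ℂ) - z)⁻¹) ^ 2 • (val R t * cW W t * (val S t)ᴴ))))) t := by
  have hne := sub_ne_zero_of_mem hz ht
  have hk : HasDerivAt (fun s : ℝ => ((s : ℂ) - z)⁻¹) (-(((t : ℂ) - z)⁻¹) ^ 2) t := by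
    have h := (((hasDerivAt_id t).ofReal_comp.sub_const z)).inv hne
    refine h.congr_deriv ?_
    simp only [id, Complex.ofReal_one]
    field_simp
  have h := MatDeriv.smul hk
    (((matDeriv_val_ofReal R t).mul (hW.matDeriv_cW ht)).mul (matDeriv_val_star S t))
  convert! h using 1
  rw [integrand, add_mul, pow_one]
  module

/-- Integration by parts: the derivative of `R W S^* / (t - z)` integrates to precisely the boundary
terms subtracted in `cauchyTerm`, so `W'` disappears. -/
theorem IsWeight.cauchyTerm_eq (hab : a < b) (hW : IsWeight a b ga gb W)
    {R S : (Matrix (Fin N) (Fin N) ℂ)[X]} {z : ℂ} (hz : z ∈ offInt a b)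
    (hT : TermExists a b W R S z) :
    cauchyTerm a b W R S z = kern a b W 2 R S z - kern a b W 1 (derivative R) S z -
      kern a b W 1 R (derivative S) z := by
  obtain ⟨hI, ⟨L, hL⟩, ⟨L', hL'⟩⟩ := hT
  have := toLeftEnd_neBot hab
  have := toRightEnd_neBot hab
  have i0 : MatIntegrable a b (integrand W R S z) := hI
  have i1 := hW.matIntegrable_kern (derivative R) S hz 1
  have i2 := hW.matIntegrable_kern R (derivative S) hz 1
  have i3 := (hW.matIntegrable_kern R S hz 2).const_smul (-1)
  have hE := matInt_add i0 (i1.add (i2.add i3))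
  have hF : matInt a b (fun t => integrand W R S z t +
      ((((t : ℂ) - z)⁻¹) ^ 1 • (val (derivative R) t * cW W t * (val S t)ᴴ) +
        ((((t : ℂ) - z)⁻¹) ^ 1 • (val R t * cW W t * (val (derivative S) t)ᴴ) +
        (-1 : ℂ) • ((((t : ℂ) - z)⁻¹) ^ 2 • (val R t * cW W t * (val S t)ᴴ))))) = L' - L := by
    ext i j
    refine integral_openInt_of_hasDerivAt hab
      (fun t ht => hW.matDeriv_boundaryFun R S hz ht i j) ((i0.add (i1.add (i2.add i3))) i j)
      ?_ ?_
    · exact (tendsto_pi_nhds.1 (tendsto_pi_nhds.1 hL i) j)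
    · exact (tendsto_pi_nhds.1 (tendsto_pi_nhds.1 hL' i) j)
  rw [matInt_add i1 (i2.add i3), matInt_add i2 i3, matInt_smul, hF] at hE
  rw [cauchyTerm, hL.limUnder_eq, hL'.limUnder_eq, hE, kern, kern, kern]
  module

/-- Existence and value of `∫ S W' R^* / (t - z) - [S W R^* / (t - z)]` by conjugation. -/
theorem IsWeight.termExists_conj (hW : IsWeight a b ga gb W) (hab : a < b)
    {R S : (Matrix (Fin N) (Fin N) ℂ)[X]} {z : ℂ}
    (hT : TermExists a b W R S ((starRingEnd ℂ) z)) :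
    TermExists a b W S R z ∧
      cauchyTerm a b W S R z = (cauchyTerm a b W R S ((starRingEnd ℂ) z))ᴴ := by
  obtain ⟨hI, ⟨L, hL⟩, ⟨L', hL'⟩⟩ := hT
  have := toLeftEnd_neBot hab
  have := toRightEnd_neBot hab
  obtain ⟨x, hx⟩ := EReal.lt_iff_exists_real_btwn.1 hab
  have hstar : Continuous fun A : Matrix (Fin N) (Fin N) ℂ => Aᴴ :=
    continuous_id.matrix_conjTranspose
  have hsymm : ∀ t ∈ openInt a b, (cW (derivW W) t)ᴴ = cW (derivW W) t := by
    intro t ht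
    ext i j
    have : (fun s => W s j i) =ᶠ[𝓝 t] fun s => W s i j := by
      filter_upwards [(isOpen_openInt a b).mem_nhds ht] with s hs
      have h := congrFun (congrFun (hW.posDef s hs).isHermitian i) j
      simpa only [conjTranspose_apply, star_trivial] using h
    simp [cW, derivW, this.deriv_eq]
  have e1 : ∀ t ∈ openInt a b,
      (boundaryFun W R S ((starRingEnd ℂ) z) t)ᴴ = boundaryFun W S R z t := by
    intro t ht
    rw [boundaryFun, boundaryFun, conjTranspose_smul, conjTranspose_mul, conjTranspose_mul,
      conjTranspose_conjTranspose, hW.cW_conjTranspose ht, mul_assoc]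
    simp
  have e2 : ∀ t ∈ openInt a b,
      (integrand W R S ((starRingEnd ℂ) z) t)ᴴ = integrand W S R z t := by
    intro t ht
    rw [integrand, integrand, conjTranspose_smul, conjTranspose_mul, conjTranspose_mul,
      conjTranspose_conjTranspose, hsymm t ht, mul_assoc]
    simp
  have f1 : Tendsto (boundaryFun W S R z) (toLeftEnd a) (𝓝 Lᴴ) := by
    refine ((hstar.tendsto L).comp hL).congr' ?_
    filter_upwards [eventually_toLeftEnd hx.1] with t ht
    exact e1 t ⟨ht.1, (EReal.coe_lt_coe_iff.2 ht.2).trans hx.2⟩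
  have f2 : Tendsto (boundaryFun W S R z) (toRightEnd b) (𝓝 L'ᴴ) := by
    refine ((hstar.tendsto L').comp hL').congr' ?_
    filter_upwards [eventually_toRightEnd hx.2] with t ht
    exact e1 t ⟨hx.1.trans (EReal.coe_lt_coe_iff.2 ht.1), ht.2⟩
  refine ⟨⟨?_, ⟨_, f1⟩, ⟨_, f2⟩⟩, ?_⟩
  · intro i j
    have h : IntegrableOn (fun t => (starRingEnd ℂ)
        (integrand W R S ((starRingEnd ℂ) z) t j i)) (openInt a b) :=
      (Complex.conjCLE.toContinuousLinearMap).integrable_comp (hI j i)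
    refine h.congr_fun (fun t ht => ?_) (measurableSet_openInt a b)
    exact congrFun (congrFun (e2 t ht) i) j
  · rw [cauchyTerm, cauchyTerm, hL.limUnder_eq, hL'.limUnder_eq, f1.limUnder_eq, f2.limUnder_eq,
      conjTranspose_sub, conjTranspose_sub, ← matInt_conjTranspose, matInt_congr e2]

end kern

/-! ### Orthogonality -/

section orth

variable {a b : EReal} {ga gb : ℝ} {W : ℝ → Matrix (Fin N) (Fin N) ℝ}
  {P : ℕ → (Matrix (Fin N) (Fin N) ℂ)[X]} {κ : ℕ → Matrix (Fin N) (Fin N) ℂ}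

theorem IsWeight.innerW_add_left (hW : IsWeight a b ga gb W)
    (R R' S : (Matrix (Fin N) (Fin N) ℂ)[X]) :
    innerW a b W (R + R') S = innerW a b W R S + innerW a b W R' S := by
  rw [innerW, innerW, innerW, ← matInt_add (hW.matIntegrable_val R S) (hW.matIntegrable_val R' S)]
  refine matInt_congr fun t _ => ?_
  rw [val_add, add_mul, add_mul]

theorem IsWeight.innerW_C_mul_left (hW : IsWeight a b ga gb W)
    (A : Matrix (Fin N) (Fin N) ℂ) (R S : (Matrix (Fin N) (Fin N) ℂ)[X]) :
    innerW a b W (C A * R) S = A * innerW a b W R S := by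
  rw [innerW, innerW, ← matInt_const_mul _ (hW.matIntegrable_val R S)]
  refine matInt_congr fun t _ => ?_
  rw [val_C_mul, mul_assoc, mul_assoc, mul_assoc]

theorem IsWeight.innerW_C_mul_right (hW : IsWeight a b ga gb W)
    (A : Matrix (Fin N) (Fin N) ℂ) (R S : (Matrix (Fin N) (Fin N) ℂ)[X]) :
    innerW a b W R (C A * S) = innerW a b W R S * Aᴴ := by
  rw [← hW.innerW_conjTranspose, hW.innerW_C_mul_left, conjTranspose_mul, hW.innerW_conjTranspose]

theorem IsWeight.innerW_sub_left (hW : IsWeight a b ga gb W)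
    (R R' S : (Matrix (Fin N) (Fin N) ℂ)[X]) :
    innerW a b W (R - R') S = innerW a b W R S - innerW a b W R' S := by
  rw [eq_sub_iff_add_eq, ← hW.innerW_add_left, sub_add_cancel]

theorem IsMonicOrthogonal.orth (hP : IsMonicOrthogonal a b W P) {n : ℕ}
    {S : (Matrix (Fin N) (Fin N) ℂ)[X]} (hS : S.degree < n) : innerW a b W (P n) S = 0 := by
  -- For `n = 0` the condition on `natDegree` in `IsMonicOrthogonal` is vacuous, but `degree < 0`
  -- forces `S = 0`.
  rcases Nat.eq_zero_or_pos n with rfl | hn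
  · have : S = 0 := by
      ext1 m
      exact (degree_lt_iff_coeff_zero _ _).1 hS m (Nat.zero_le _)
    subst this
    simp only [innerW, val_zero, conjTranspose_zero, mul_zero]
    ext i j
    simp [matInt]
  · refine (hP n).2.2 S ((Nat.lt_iff_le_pred hn).2 (natDegree_le_iff_coeff_eq_zero.2 fun m hm => ?_))
    exact (degree_lt_iff_coeff_zero _ _).1 hS m (by omega)

theorem IsMonicOrthogonal.orth' (hP : IsMonicOrthogonal a b W P) (hW : IsWeight a b ga gb W)
    {n : ℕ} {S : (Matrix (Fin N) (Fin N) ℂ)[X]} (hS : S.degree < n) :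
    innerW a b W S (P n) = 0 := by
  rw [← hW.innerW_conjTranspose, hP.orth hS, conjTranspose_zero]

theorem IsMonicOrthogonal.degree_lt (hP : IsMonicOrthogonal a b W P) (n : ℕ) :
    (P n).degree < (n + 1 : ℕ) := by
  rw [degree_lt_iff_coeff_zero]
  intro m hm
  exact coeff_eq_zero_of_natDegree_lt (by have := (hP n).1; omega)

theorem IsNormalizedBy.gam_mul_innerW (hκ : IsNormalizedBy a b W P κ)
    (hW : IsWeight a b ga gb W) (n : ℕ) : gam κ n * innerW a b W (P n) (P n) = 1 := by
  have h := hκ n n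
  rw [if_pos rfl, hW.innerW_C_mul_left, hW.innerW_C_mul_right] at h
  -- Cyclic rotation of `κ h κ^* = 1`: one-sided inverses of square matrices are two-sided.
  rw [mul_eq_one_comm, gam, ← mul_assoc, mul_eq_one_comm]
  exact h

/-- A monic polynomial of degree `n` has the same product with `P n` as `P n` itself. -/
theorem IsMonicOrthogonal.innerW_of_coeff (hP : IsMonicOrthogonal a b W P)
    (hW : IsWeight a b ga gb W) {n : ℕ} {S : (Matrix (Fin N) (Fin N) ℂ)[X]}
    (hS : S.degree < (n + 1 : ℕ)) :
    innerW a b W S (P n) = S.coeff n * innerW a b W (P n) (P n) := by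
  rw [← hW.innerW_C_mul_left, ← sub_eq_zero, ← hW.innerW_sub_left]
  refine hP.orth' hW ?_
  have h := hP.degree_lt n
  rw [degree_lt_iff_coeff_zero] at hS h ⊢
  intro m hm
  rw [coeff_sub, coeff_C_mul]
  rcases hm.eq_or_lt with rfl | hm
  · rw [(hP n).2.1, mul_one, sub_self]
  · rw [hS m (by omega), h m (by omega), mul_zero, sub_zero]

/-- A polynomial of degree less than `n` orthogonal to all polynomials of degree less than `n`
vanishes. -/
theorem eq_zero_of_innerW_eq_zero (hP : IsMonicOrthogonal a b W P)
    (hκ : IsNormalizedBy a b W P κ) (hW : IsWeight a b ga gb W) (n : ℕ)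
    {S : (Matrix (Fin N) (Fin N) ℂ)[X]} (hS : S.degree < n)
    (h : ∀ m < n, innerW a b W S (P m) = 0) : S = 0 := by
  induction n with
  | zero =>
    ext1 m
    exact (degree_lt_iff_coeff_zero _ _).1 hS m (Nat.zero_le _)
  | succ n ih =>
    have h0 := h n (Nat.lt_succ_self n)
    rw [hP.innerW_of_coeff hW hS] at h0
    have h1 := mul_eq_one_comm.1 (hκ.gam_mul_innerW hW n)
    have h2 : S.coeff n = 0 := by
      rw [← mul_one (S.coeff n), ← h1, ← mul_assoc, h0, zero_mul]
    refine ih ?_ fun m hm => h m (hm.trans (Nat.lt_succ_self n))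
    rw [degree_lt_iff_coeff_zero] at hS ⊢
    intro m hm
    rcases hm.eq_or_lt with rfl | hm
    · exact h2
    · exact hS m hm

/-! ### The coefficients in terms of Cauchy transforms -/

/-- After integration by parts each kernel is expanded around `z` or `conj z`. The remainders pair
`P s` with degree below `r - 1`, or `P r` with degree below `s - 1`, and vanish since `|r - s| ≤ 1`.
The two terms containing `P_s'(conj z)^*` cancel. -/
theorem IsWeight.cauchyTerm_eq_of_orth (hW : IsWeight a b ga gb W) (hab : a < b)
    (hP : IsMonicOrthogonal a b W P) {r s : ℕ} (hrs : r ≤ s + 1) (hsr : s ≤ r + 1) {z : ℂ}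
    (hz : z ∈ offInt a b) (hT : TermExists a b W (P r) (P s) z) :
    cauchyTerm a b W (P r) (P s) z =
      kern a b W 2 (P r) 1 z * (val (P s) ((starRingEnd ℂ) z))ᴴ -
        val (derivative (P r)) z * kern a b W 1 1 (P s) z := by
  have hder : ∀ n : ℕ, (derivative (P n)).degree < n := by
    intro n
    have := hP.degree_lt n
    rw [degree_lt_iff_coeff_zero] at this ⊢
    intro m hm
    rw [coeff_derivative, this (m + 1) (by omega), zero_mul]
  have hle : ∀ {p q : ℕ} {R : (Matrix (Fin N) (Fin N) ℂ)[X]}, R.degree < p → p ≤ q →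
      R.degree < q := fun h hpq => h.trans_le (by exact_mod_cast hpq)
  obtain ⟨A, hA, -, hAe⟩ := exists_divided_difference z r (derivative (P r)) (hder r)
  obtain ⟨B, hB, -, hBe⟩ := exists_divided_difference ((starRingEnd ℂ) z) s
    (derivative (P s)) (hder s)
  obtain ⟨D, hD, -, hDe⟩ := exists_divided_difference ((starRingEnd ℂ) z) (s + 1)
    (P s) (hP.degree_lt s)
  obtain ⟨E, hE, -, hEe⟩ := exists_divided_difference ((starRingEnd ℂ) z) s D (by simpa using hD)
  rw [hW.cauchyTerm_eq hab hz hT, hW.kern_reduce_left (P s) hz 0 hAe,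
    hW.kern_reduce_right (P r) hz 0 hBe, hW.kern_reduce_right (P r) hz 1 hDe,
    hW.kern_reduce_right (P r) hz 0 hEe, kern_zero, kern_zero, kern_zero,
    hP.orth' hW (hle hA (by omega)), hP.orth (hle hB (by omega)), hP.orth (hle hE (by omega)),
    divided_difference_self hDe]
  abel

/-- The transform of `R W S^*` is computed twice, expanding the right factor or the left one. For
orthogonal polynomials the right-hand side is explicit. -/
theorem IsWeight.wronskian (hW : IsWeight a b ga gb W)
    {R R' S S' : (Matrix (Fin N) (Fin N) ℂ)[X]} {z : ℂ} (hz : z ∈ offInt a b)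
    (hR : ∀ t, val R t = val R z + (t - z) • val R' t)
    (hS : ∀ t, val S t = val S ((starRingEnd ℂ) z) + (t - (starRingEnd ℂ) z) • val S' t) :
    kern a b W 1 R 1 z * (val S ((starRingEnd ℂ) z))ᴴ - val R z * kern a b W 1 1 S z =
      innerW a b W R' S - innerW a b W R S' := by
  have h1 := hW.kern_reduce_right R hz 0 hS
  have h2 := hW.kern_reduce_left S hz 0 hR
  rw [kern_zero] at h1 h2
  rw [eq_sub_of_add_eq h1.symm, eq_sub_of_add_eq h2.symm]
  abel

/-- The four Wronskians `w1` to `w4` of the pair exhibit a right inverse of a block matrix that is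
`Y` up to scalar factors. Multiplying in the other order yields the four stated relations. -/
theorem wronskian_blocks (hP : IsMonicOrthogonal a b W P) (hκ : IsNormalizedBy a b W P κ)
    (hW : IsWeight a b ga gb W) (m : ℕ) {z : ℂ} (hz : z ∈ offInt a b) :
    let p := val (P (m + 1)) z
    let q := val (P m) z
    let ps := (val (P (m + 1)) ((starRingEnd ℂ) z))ᴴ
    let qs := (val (P m) ((starRingEnd ℂ) z))ᴴ
    let c := kern a b W 1 (P (m + 1)) 1 z
    let d := kern a b W 1 (P m) 1 z
    let cs := kern a b W 1 1 (P (m + 1)) z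
    let ds := kern a b W 1 1 (P m) z
    let g := gam κ m
    qs * g * p = ps * g * q ∧ qs * g * c - ps * g * d = 1 ∧
      cs * g * q - ds * g * p = 1 ∧ ds * g * c = cs * g * d := by
  intro p q ps qs c d cs ds g
  have hdd : ∀ (w : ℂ) (n : ℕ), ∃ R : (Matrix (Fin N) (Fin N) ℂ)[X], R.degree < n ∧
      (∀ k, k + 1 = n → R.coeff k = 1) ∧
      ∀ t, val (P n) t = val (P n) w + (t - w) • val R t := by
    intro w n
    obtain ⟨R, h1, h2, h3⟩ := exists_divided_difference w (n + 1) (P n) (hP.degree_lt n)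
    refine ⟨R, by simpa using h1, fun k hk => ?_, h3⟩
    rw [h2 k (by omega), hk, (hP n).2.1]
  obtain ⟨A, hA, hA1, hAe⟩ := hdd z (m + 1)
  obtain ⟨B, hB, -, hBe⟩ := hdd z m
  obtain ⟨A', hA', hA1', hAe'⟩ := hdd ((starRingEnd ℂ) z) (m + 1)
  obtain ⟨B', hB', -, hBe'⟩ := hdd ((starRingEnd ℂ) z) m
  have hlt : ∀ {R : (Matrix (Fin N) (Fin N) ℂ)[X]}, R.degree < m → R.degree < (m + 1 : ℕ) :=
    fun h => h.trans (by exact_mod_cast Nat.lt_succ_self m)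
  have hg := hκ.gam_mul_innerW hW m
  have hg' := mul_eq_one_comm.1 hg
  have w1 : c * qs - p * ds = innerW a b W (P m) (P m) := by
    have := hW.wronskian hz hAe hBe'
    rw [hP.innerW_of_coeff hW hA, hA1 m rfl, one_mul, hP.orth (hlt hB'), sub_zero] at this
    exact this
  have w2 : c * ps - p * cs = 0 := by
    have := hW.wronskian hz hAe hAe'
    rwa [hP.orth' hW hA, hP.orth hA', sub_zero] at this
  have w3 : d * qs - q * ds = 0 := by
    have := hW.wronskian hz hBe hBe'
    rwa [hP.orth' hW hB, hP.orth hB', sub_zero] at this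
  have w4 : d * ps - q * cs = -innerW a b W (P m) (P m) := by
    have := hW.wronskian hz hBe hAe'
    rw [hP.orth' hW (hlt hB), zero_sub, ← hW.innerW_conjTranspose A' (P m),
      hP.innerW_of_coeff hW hA', hA1' m rfl, one_mul, hW.innerW_conjTranspose] at this
    exact this
  have hprod : fromBlocks p c (g * q) (g * d) * fromBlocks (-(ds * g)) cs (qs * g) (-ps) =
      (1 : Matrix (Fin N ⊕ Fin N) (Fin N ⊕ Fin N) ℂ) := by
    rw [fromBlocks_multiply, ← fromBlocks_one, fromBlocks_inj]
    refine ⟨?_, ?_, ?_, ?_⟩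
    · calc _ = (c * qs - p * ds) * g := by noncomm_ring
        _ = 1 := by rw [w1, hg']
    · calc _ = -(c * ps - p * cs) := by noncomm_ring
        _ = 0 := by rw [w2, neg_zero]
    · calc _ = g * (d * qs - q * ds) * g := by noncomm_ring
        _ = 0 := by rw [w3, mul_zero, zero_mul]
    · calc _ = -(g * (d * ps - q * cs)) := by noncomm_ring
        _ = 1 := by rw [w4, mul_neg, neg_neg, hg]
  rw [mul_eq_one_comm, fromBlocks_multiply, ← fromBlocks_one, fromBlocks_inj] at hprod
  obtain ⟨e1, e2, e3, e4⟩ := hprod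
  refine ⟨?_, ?_, ?_, ?_⟩
  · rw [← sub_eq_zero, ← e3]; noncomm_ring
  · rw [← e4]; noncomm_ring
  · rw [← e1]; noncomm_ring
  · rw [← sub_eq_zero, ← neg_eq_zero, ← e2]; noncomm_ring

/-- The linear system for `P (m + 1)`, `P m` and their Cauchy transforms. -/
theorem linear_system (hP : IsMonicOrthogonal a b W P) (hκ : IsNormalizedBy a b W P κ)
    (hW : IsWeight a b ga gb W) (hab : a < b) (m r : ℕ) (hr : r = m ∨ r = m + 1) {z : ℂ}
    (hz : z ∈ offInt a b) (h1 : TermExists a b W (P r) (P m) z)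
    (h2 : TermExists a b W (P r) (P (m + 1)) z) :
    val (derivative (P r)) z =
      cauchyTerm a b W (P r) (P m) z * gam κ m * val (P (m + 1)) z -
        cauchyTerm a b W (P r) (P (m + 1)) z * gam κ m * val (P m) z ∧
    kern a b W 2 (P r) 1 z =
      cauchyTerm a b W (P r) (P m) z * gam κ m * kern a b W 1 (P (m + 1)) 1 z -
        cauchyTerm a b W (P r) (P (m + 1)) z * gam κ m * kern a b W 1 (P m) 1 z := by
  obtain ⟨e1, e2, e3, e4⟩ := wronskian_blocks hP hκ hW m hz
  rw [hW.cauchyTerm_eq_of_orth hab hP (by omega) (by omega) hz h1,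
    hW.cauchyTerm_eq_of_orth hab hP (by omega) (by omega) hz h2]
  -- Here `u` and `v` stand for the unknowns `kern a b W 2 (P r) 1 z` and `P_r'(z)`. The pair `(p,
  -- q)` isolates `v`, and the pair of Cauchy transforms in its place isolates `u`.
  have alg : ∀ u v ps qs cs ds g p q : Matrix (Fin N) (Fin N) ℂ,
      (u * qs - v * ds) * g * p - (u * ps - v * cs) * g * q =
        u * (qs * g * p - ps * g * q) + v * (cs * g * q - ds * g * p) := by
    intros
    noncomm_ring
  constructor
  · rw [alg, e1, e3, sub_self, mul_zero, zero_add, mul_one]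
  · rw [alg, e2, e4, sub_self, mul_zero, add_zero, mul_one]

end orth

/-! ### Solutions of the Riemann-Hilbert problem -/

theorem nhdsWithin_lower_neBot (x : ℝ) : (𝓝[{w : ℂ | w.im < 0}] (x : ℂ)).NeBot := by
  have h : Tendsto (fun ε : ℝ => (x : ℂ) - ε * Complex.I) (𝓝[>] 0)
      (𝓝[{w : ℂ | w.im < 0}] (x : ℂ)) := by
    refine tendsto_nhdsWithin_iff.2 ⟨?_, ?_⟩
    · have : Continuous fun ε : ℝ => (x : ℂ) - ε * Complex.I := by fun_prop
      exact (this.tendsto' 0 (x : ℂ) (by simp)).mono_left nhdsWithin_le_nhds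
    · filter_upwards [self_mem_nhdsWithin] with ε hε
      simpa using hε
  exact h.neBot

theorem exists_rpow_bound_of_endGrowth {a b : EReal} (hab : a < b) {c g : ℝ} (hg : -1 < g)
    (hc : (c : EReal) = a ∨ (c : EReal) = b) : ∃ g' : ℝ, -1 < g' ∧ g' ≤ 0 ∧
      endGrowth c g =O[𝓝[offInt a b] (c : ℂ)] fun w => ‖w - c‖ ^ g' := by
  rcases lt_trichotomy g 0 with h | h | h
  · refine ⟨g, hg, h.le, Asymptotics.isBigO_of_le _ fun w => ?_⟩
    simp [endGrowth, h]
  -- A logarithm is dominated by any negative power; `-1/2` is one that is still integrable.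
  · refine ⟨-1 / 2, by norm_num, by norm_num, ?_⟩
    have ht : Tendsto (fun w : ℂ => ‖w - c‖) (𝓝[offInt a b] (c : ℂ)) (𝓝[>] 0) := by
      refine tendsto_nhdsWithin_iff.2 ⟨?_, ?_⟩
      · have : Continuous fun w : ℂ => ‖w - c‖ := by fun_prop
        exact (this.tendsto' (c : ℂ) 0 (by simp)).mono_left nhdsWithin_le_nhds
      · filter_upwards [self_mem_nhdsWithin] with w hw
        refine norm_pos_iff.2 (sub_ne_zero.2 ?_)
        rintro rfl
        rcases hc with hc | hc
        · exact ofReal_notMem_offInt hc.ge (hc ▸ hab.le) hw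
        · exact ofReal_notMem_offInt (hc ▸ hab.le) hc.le hw
    have h1 := ((isLittleO_log_rpow_nhdsGT_zero (r := -1 / 2) (by norm_num)).isBigO).comp_tendsto ht
    refine h1.congr_left fun w => ?_
    simp [endGrowth, h]
  · refine ⟨0, by norm_num, le_rfl, Asymptotics.isBigO_of_le _ fun w => ?_⟩
    simp [endGrowth, h.not_gt, h.ne']

theorem exists_matrix_polynomial (n : ℕ) (p : Fin N → Fin N → ℂ[X])
    (hp : ∀ i j, (p i j).degree < n) : ∃ R : (Matrix (Fin N) (Fin N) ℂ)[X], R.degree < n ∧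
      ∀ w i j, val R w i j = (p i j).eval w := by
  refine ⟨matPolyEquiv (Matrix.of p), ?_, fun w i j => ?_⟩
  · rw [degree_lt_iff_coeff_zero]
    intro m hm
    ext i j
    rw [matPolyEquiv_coeff_apply]
    exact (degree_lt_iff_coeff_zero _ _).1 (hp i j) m hm
  · exact matPolyEquiv_eval (Matrix.of p) w i j

section RH

variable {a b : EReal} {ga gb : ℝ} {W : ℝ → Matrix (Fin N) (Fin N) ℝ} {n : ℕ}
  {Y : ℂ → Matrix (Fin N ⊕ Fin N) (Fin N ⊕ Fin N) ℂ}

theorem IsRHSolution.cut_left (hY : IsRHSolution a b ga gb W n Y) (i : Fin N ⊕ Fin N) (j : Fin N) :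
    CutFunction a b (fun z => Y z i (Sum.inl j)) 0 := by
  obtain ⟨Yp, Ym, -, -, hp, hm, hj⟩ := hY.jump
  refine ⟨(hY.analytic i (Sum.inl j)).differentiableOn, fun x hx => ?_, fun c hc => ?_⟩
  · refine ⟨Yp x i (Sum.inl j), Ym x i (Sum.inl j),
      tendsto_pi_nhds.1 (tendsto_pi_nhds.1 (hp x hx) i) _,
      tendsto_pi_nhds.1 (tendsto_pi_nhds.1 (hm x hx) i) _, ?_⟩
    rw [hj x hx]
    simp [Matrix.mul_apply, Matrix.one_apply]
  · refine ⟨0, by norm_num, le_rfl, ?_⟩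
    simp only [Real.rpow_zero]
    rcases hc with hc | hc
    · exact (hY.left_end c hc i j).1
    · exact (hY.right_end c hc i j).1

/-- The map `e` selects the upper or lower block row, so that both are treated at once. -/
theorem IsRHSolution.cut_right (hY : IsRHSolution a b ga gb W n Y) (hW : IsWeight a b ga gb W)
    (hab : a < b) (e : Fin N → Fin N ⊕ Fin N) {S : (Matrix (Fin N) (Fin N) ℂ)[X]}
    (hS : ∀ w ∈ offInt a b, ∀ i j, Y w (e i) (Sum.inl j) = val S w i j) (i j : Fin N) :
    CutFunction a b (fun z => Y z (e i) (Sum.inr j)) fun x => (val S x * cW W x) i j := by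
  obtain ⟨Yp, Ym, -, -, hp, hm, hj⟩ := hY.jump
  refine ⟨(hY.analytic (e i) (Sum.inr j)).differentiableOn, fun x hx => ?_, fun c hc => ?_⟩
  · refine ⟨Yp x (e i) (Sum.inr j), Ym x (e i) (Sum.inr j),
      tendsto_pi_nhds.1 (tendsto_pi_nhds.1 (hp x hx) _) _,
      tendsto_pi_nhds.1 (tendsto_pi_nhds.1 (hm x hx) _) _, ?_⟩
    -- The first column is a polynomial off the cut, so its lower boundary value is the value of
    -- that polynomial.
    have hv : ∀ k, Ym x (e i) (Sum.inl k) = val S x i k := by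
      intro k
      have := nhdsWithin_lower_neBot x
      refine tendsto_nhds_unique (tendsto_pi_nhds.1 (tendsto_pi_nhds.1 (hm x hx) _) _) ?_
      refine (((matDeriv_val S x i k).continuousAt.tendsto).mono_left nhdsWithin_le_nhds).congr' ?_
      filter_upwards [self_mem_nhdsWithin] with w hw
      exact (hS w (lower_subset_offInt a b hw) i k).symm
    rw [hj x hx]
    simp [Matrix.mul_apply, Matrix.one_apply, hv]
  · rcases hc with hc | hc
    · obtain ⟨g, h1, h2, h3⟩ := exists_rpow_bound_of_endGrowth hab (hW.left_end c hc).1 (Or.inl hc)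
      exact ⟨g, h1, h2, (hY.left_end c hc (e i) j).2.trans h3⟩
    · obtain ⟨g, h1, h2, h3⟩ := exists_rpow_bound_of_endGrowth hab (hW.right_end c hc).1 (Or.inr hc)
      exact ⟨g, h1, h2, (hY.right_end c hc (e i) j).2.trans h3⟩

theorem IsRHSolution.infinity_right (hY : IsRHSolution a b ga gb W n Y) (i : Fin N ⊕ Fin N)
    (j : Fin N) : (fun z => z ^ n * Y z i (Sum.inr j) -
      (1 : Matrix (Fin N ⊕ Fin N) (Fin N ⊕ Fin N) ℂ) i (Sum.inr j))
      =O[Bornology.cobounded ℂ ⊓ 𝓟 (offInt a b)] fun z => z⁻¹ := by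
  obtain ⟨Yc, hYc⟩ := hY.at_infinity
  have h := hYc 0 i (Sum.inr j)
  simp only [zero_add, pow_one] at h
  refine h.congr_left fun z => ?_
  simp [Matrix.mul_apply, Matrix.one_apply, mul_comm]

theorem IsRHSolution.infinity_left (hY : IsRHSolution a b ga gb W n Y) (i : Fin N ⊕ Fin N)
    (j : Fin N) : (fun z => Y z i (Sum.inl j) -
      (1 : Matrix (Fin N ⊕ Fin N) (Fin N ⊕ Fin N) ℂ) i (Sum.inl j) * z ^ n)
      =O[Bornology.cobounded ℂ ⊓ 𝓟 (offInt a b)] fun z => z ^ n * z⁻¹ := by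
  obtain ⟨Yc, hYc⟩ := hY.at_infinity
  have h := hYc 0 i (Sum.inl j)
  simp only [zero_add, pow_one] at h
  have h2 := (Asymptotics.isBigO_refl (fun z : ℂ => z ^ n)
    (Bornology.cobounded ℂ ⊓ 𝓟 (offInt a b))).mul h
  refine h2.congr' ?_ EventuallyEq.rfl
  have hne : ∀ᶠ z in Bornology.cobounded ℂ ⊓ 𝓟 (offInt a b), z ≠ 0 :=
    (Bornology.eventually_ne_cobounded (0 : ℂ)).filter_mono inf_le_left
  filter_upwards [hne] with z hz
  have : z ^ n ≠ 0 := pow_ne_zero _ hz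
  simp only [Matrix.sub_apply, Matrix.add_apply, Matrix.mul_apply, Matrix.one_apply,
    Fintype.sum_sum_type]
  split_ifs <;> simp [Matrix.one_apply] <;> field_simp

theorem IsRHSolution.exists_left (hY : IsRHSolution a b ga gb W n Y) (hab : a < b)
    (e : Fin N → Fin N ⊕ Fin N) : ∃ R : (Matrix (Fin N) (Fin N) ℂ)[X], R.degree < n ∧
      ∀ w ∈ offInt a b, ∀ i j, Y w (e i) (Sum.inl j) =
        (1 : Matrix (Fin N ⊕ Fin N) (Fin N ⊕ Fin N) ℂ) (e i) (Sum.inl j) * w ^ n + val R w i j := by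
  have h : ∀ i j, ∃ p : ℂ[X], p.degree < n ∧ ∀ w ∈ offInt a b,
      Y w (e i) (Sum.inl j) -
        (1 : Matrix (Fin N ⊕ Fin N) (Fin N ⊕ Fin N) ℂ) (e i) (Sum.inl j) * w ^ n = p.eval w := by
    intro i j
    refine CutFunction.exists_polynomial hab.le n ?_ (hY.infinity_left (e i) j)
    have := (hY.cut_left (e i) j).affine (α := fun _ => 1)
      (β := fun w => -((1 : Matrix (Fin N ⊕ Fin N) (Fin N ⊕ Fin N) ℂ) (e i) (Sum.inl j) * w ^ n))
      (H := fun w => Y w (e i) (Sum.inl j) -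
        (1 : Matrix (Fin N ⊕ Fin N) (Fin N ⊕ Fin N) ℂ) (e i) (Sum.inl j) * w ^ n)
      (fun x => by fun_prop) (fun x => by fun_prop)
      ((hY.cut_left (e i) j).diff.sub (by fun_prop)) hab.le
      fun x => Eventually.of_forall fun w => by ring
    convert! this using 1
    ext x
    simp
  choose p hp hpe using h
  obtain ⟨R, hR, hRe⟩ := exists_matrix_polynomial n p hp
  refine ⟨R, hR, fun w hw i j => ?_⟩
  rw [hRe, ← hpe i j w hw]
  ring

/-! ### Orthogonality from the decay of the second block column. -/

theorem integral_pow_mul (S : (Matrix (Fin N) (Fin N) ℂ)[X]) (k : ℕ) (i j : Fin N) :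
    ∫ t in openInt a b, (t : ℂ) ^ k * (val S t * cW W t) i j =
      innerW a b W S (monomial k 1) i j := by
  rw [innerW, matInt, of_apply]
  refine setIntegral_congr_fun (measurableSet_openInt a b) fun t ht => ?_
  simp only [val_monomial, conjTranspose_smul, conjTranspose_one, mul_smul_comm, mul_one, star_pow,
    Matrix.smul_apply, smul_eq_mul, show star (t : ℂ) = t from Complex.conj_ofReal t]

theorem IsWeight.integrableOn_pow_mul (hW : IsWeight a b ga gb W)
    (S : (Matrix (Fin N) (Fin N) ℂ)[X]) (k : ℕ) (i j : Fin N) :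
    IntegrableOn (fun t : ℝ => (t : ℂ) ^ k * (val S t * cW W t) i j) (openInt a b) := by
  refine ((hW.matIntegrable_val S (monomial k 1)) i j).congr_fun (fun t ht => ?_)
    (measurableSet_openInt a b)
  simp only [val_monomial, conjTranspose_smul, conjTranspose_one, mul_smul_comm, mul_one, star_pow,
    Matrix.smul_apply, smul_eq_mul, show star (t : ℂ) = t from Complex.conj_ofReal t]

theorem IsWeight.innerW_add_right (hW : IsWeight a b ga gb W)
    (R S S' : (Matrix (Fin N) (Fin N) ℂ)[X]) :
    innerW a b W R (S + S') = innerW a b W R S + innerW a b W R S' := by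
  rw [← hW.innerW_conjTranspose, hW.innerW_add_left, conjTranspose_add, hW.innerW_conjTranspose,
    hW.innerW_conjTranspose]

theorem IsWeight.innerW_sum_right (hW : IsWeight a b ga gb W)
    (R : (Matrix (Fin N) (Fin N) ℂ)[X]) (s : Finset ℕ) (f : ℕ → (Matrix (Fin N) (Fin N) ℂ)[X]) :
    innerW a b W R (∑ k ∈ s, f k) = ∑ k ∈ s, innerW a b W R (f k) :=
  map_sum (AddMonoidHom.mk' (innerW a b W R) (hW.innerW_add_right R)) f s

theorem IsWeight.innerW_of_moments (hW : IsWeight a b ga gb W)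
    {S : (Matrix (Fin N) (Fin N) ℂ)[X]} {m : ℕ} {A : Matrix (Fin N) (Fin N) ℂ}
    (h0 : ∀ k < m, innerW a b W S (monomial k 1) = 0)
    (h1 : innerW a b W S (monomial m 1) = A) {Q : (Matrix (Fin N) (Fin N) ℂ)[X]}
    (hQ : Q.degree < (m + 1 : ℕ)) : innerW a b W S Q = A * (Q.coeff m)ᴴ := by
  have hexp : Q = ∑ k ∈ Finset.range (m + 1), C (Q.coeff k) * monomial k 1 := by
    conv_lhs => rw [as_sum_range' Q (m + 1) (Nat.lt_succ_of_le
      (natDegree_le_iff_coeff_eq_zero.2 fun k hk => (degree_lt_iff_coeff_zero _ _).1 hQ k hk))]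
    refine Finset.sum_congr rfl fun k _ => ?_
    rw [C_mul_monomial, mul_one]
  conv_lhs => rw [hexp]
  rw [hW.innerW_sum_right, Finset.sum_range_succ, Finset.sum_eq_zero, zero_add,
    hW.innerW_C_mul_right, h1]
  intro k hk
  rw [hW.innerW_C_mul_right, h0 k (Finset.mem_range.1 hk), zero_mul]

/-- The second column is `O(z ^ (-n))`, so the moments of `S W` of order below `m = n - 1` vanish,
and the one of order `m` is `-2πi` times the leading block at infinity. -/
theorem IsRHSolution.innerW_row (hY : IsRHSolution a b ga gb W n Y) (hW : IsWeight a b ga gb W)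
    (hab : a < b) (e : Fin N → Fin N ⊕ Fin N) {S : (Matrix (Fin N) (Fin N) ℂ)[X]}
    (hS : ∀ w ∈ offInt a b, ∀ i j, Y w (e i) (Sum.inl j) = val S w i j) {m : ℕ} (hm : n = m + 1)
    {Q : (Matrix (Fin N) (Fin N) ℂ)[X]} (hQ : Q.degree < (m + 1 : ℕ)) :
    innerW a b W S Q = (-(2 * Real.pi * Complex.I)) •
      ((1 : Matrix (Fin N ⊕ Fin N) (Fin N ⊕ Fin N) ℂ).submatrix e Sum.inr * (Q.coeff m)ᴴ) := by
  subst hm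
  rw [← smul_mul_assoc]
  refine hW.innerW_of_moments (fun k hk => ?_) ?_ hQ
  · ext i j
    rw [← integral_pow_mul]
    have h := (hY.cut_right hW hab e hS i j).moment (k := k) (A := 0) hab.le
      (fun k => hW.integrableOn_pow_mul S k i j)
      (isBigO_pow_mul_of_lt (by omega) (hY.infinity_right (e i) j))
      (by simpa using isBigO_pow_mul_of_lt (by omega) (hY.infinity_right (e i) j))
    simpa using h
  · ext i j
    rw [← integral_pow_mul]
    exact (hY.cut_right hW hab e hS i j).moment hab.le
      (fun k => hW.integrableOn_pow_mul S k i j)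
      (isBigO_pow_mul_of_lt (by omega) (hY.infinity_right (e i) j)) (hY.infinity_right (e i) j)

/-- The condition `hn` excludes the lower row at `n = 0`, whose right block tends to the identity
instead of decaying. -/
theorem IsRHSolution.cauchy_row (hY : IsRHSolution a b ga gb W n Y) (hW : IsWeight a b ga gb W)
    (hab : a < b) (e : Fin N → Fin N ⊕ Fin N) {S : (Matrix (Fin N) (Fin N) ℂ)[X]}
    (hS : ∀ w ∈ offInt a b, ∀ i j, Y w (e i) (Sum.inl j) = val S w i j)
    (hn : 0 < n ∨ ∀ i j, (1 : Matrix (Fin N ⊕ Fin N) (Fin N ⊕ Fin N) ℂ) (e i) (Sum.inr j) = 0)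
    {z : ℂ} (hz : z ∈ offInt a b)
    (i j : Fin N) : Y z (e i) (Sum.inr j) =
      (2 * Real.pi * Complex.I)⁻¹ * kern a b W 1 S 1 z i j := by
  have hdec : (fun w => Y w (e i) (Sum.inr j))
      =O[Bornology.cobounded ℂ ⊓ 𝓟 (offInt a b)] fun w => w⁻¹ := by
    rcases Nat.eq_zero_or_pos n with h | h
    · have h1 := hY.infinity_right (e i) j
      rcases hn with hn | hn
      · omega
      · simpa [h, hn i j] using h1
    · simpa using isBigO_pow_mul_of_lt h (hY.infinity_right (e i) j)
  have h1 := (hY.cut_right hW hab e hS i j).eq_cauchy hab.le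
    (by simpa using hW.integrableOn_pow_mul S 0 i j) hdec hz
  have h2 : kern a b W 1 S 1 z i j =
      ∫ t in openInt a b, ((t : ℂ) - z)⁻¹ * (val S t * cW W t) i j := by
    simp [kern, matInt, val_one]
  rw [h2, ← h1, inv_mul_cancel_left₀ Complex.two_pi_I_ne_zero]

end RH

/-! ### The explicit solution and its derivative. -/

section solution

variable {a b : EReal} {ga gb : ℝ} {W : ℝ → Matrix (Fin N) (Fin N) ℝ} {n : ℕ}
  {Y : ℂ → Matrix (Fin N ⊕ Fin N) (Fin N ⊕ Fin N) ℂ}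
  {P : ℕ → (Matrix (Fin N) (Fin N) ℂ)[X]} {κ : ℕ → Matrix (Fin N) (Fin N) ℂ}

theorem kern_C_mul_left (hW : IsWeight a b ga gb W) (A : Matrix (Fin N) (Fin N) ℂ)
    (R S : (Matrix (Fin N) (Fin N) ℂ)[X]) {z : ℂ} (hz : z ∈ offInt a b) (k : ℕ) :
    kern a b W k (C A * R) S z = A * kern a b W k R S z := by
  rw [kern, kern, ← matInt_const_mul _ (hW.matIntegrable_kern R S hz k)]
  refine matInt_congr fun t _ => ?_
  rw [val_C_mul, mul_smul_comm, mul_assoc, mul_assoc, mul_assoc]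

theorem IsRHSolution.eq_left_upper (hY : IsRHSolution a b ga gb W n Y)
    (hP : IsMonicOrthogonal a b W P) (hκ : IsNormalizedBy a b W P κ)
    (hW : IsWeight a b ga gb W) (hab : a < b) :
    ∀ w ∈ offInt a b, ∀ i j, Y w (Sum.inl i) (Sum.inl j) = val (P n) w i j := by
  obtain ⟨R, hR, hRe⟩ := hY.exists_left hab Sum.inl
  have hS : ∀ w ∈ offInt a b, ∀ i j,
      Y w (Sum.inl i) (Sum.inl j) = val (monomial n 1 + R) w i j := by
    intro w hw i j
    rw [hRe w hw i j, val_add, val_monomial]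
    simp [Matrix.one_apply]
  -- Both polynomials are monic of degree `n` and orthogonal to all lower degrees, so their
  -- difference is orthogonal to itself and to its whole degree class.
  have h0 : monomial n 1 + R - P n = 0 := by
    refine eq_zero_of_innerW_eq_zero hP hκ hW n ?_ fun m hm => ?_
    · have h := hP.degree_lt n
      rw [degree_lt_iff_coeff_zero] at hR h ⊢
      intro m hm
      rw [coeff_sub, coeff_add, hR m hm, coeff_monomial]
      rcases hm.eq_or_lt with rfl | hm
      · rw [if_pos rfl, (hP n).2.1, add_zero, sub_self]
      · rw [if_neg (by omega), h m (by omega), add_zero, sub_zero]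
    · have hlt : ∀ q, m < q → (P m).degree < q := fun q hq =>
        (hP.degree_lt m).trans_le (by exact_mod_cast hq)
      obtain ⟨l, rfl⟩ : ∃ l, n = l + 1 := ⟨n - 1, by omega⟩
      rw [hW.innerW_sub_left, hP.orth (hlt _ hm), sub_zero,
        hY.innerW_row hW hab Sum.inl hS rfl (hlt _ hm)]
      have : (1 : Matrix (Fin N ⊕ Fin N) (Fin N ⊕ Fin N) ℂ).submatrix Sum.inl Sum.inr = 0 := by
        ext i j
        simp
      rw [this, zero_mul, smul_zero]
  intro w hw i j
  rw [hS w hw, sub_eq_zero.1 h0]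

/-- The factor is fixed by pairing with `P m`: the row gives `-2πi` there, while `γ_m` inverts the
norm of `P m`. -/
theorem IsRHSolution.eq_left_lower {m : ℕ} (hY : IsRHSolution a b ga gb W (m + 1) Y)
    (hP : IsMonicOrthogonal a b W P) (hκ : IsNormalizedBy a b W P κ)
    (hW : IsWeight a b ga gb W) (hab : a < b) :
    ∀ w ∈ offInt a b, ∀ i j, Y w (Sum.inr i) (Sum.inl j) =
      val (C ((-(2 * Real.pi * Complex.I)) • gam κ m) * P m) w i j := by
  obtain ⟨R, hR, hRe⟩ := hY.exists_left hab Sum.inr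
  have hS : ∀ w ∈ offInt a b, ∀ i j, Y w (Sum.inr i) (Sum.inl j) = val R w i j := by
    intro w hw i j
    rw [hRe w hw i j]
    simp
  have h0 : R - C ((-(2 * Real.pi * Complex.I)) • gam κ m) * P m = 0 := by
    refine eq_zero_of_innerW_eq_zero hP hκ hW (m + 1) ?_ fun k hk => ?_
    · have h := hP.degree_lt m
      rw [degree_lt_iff_coeff_zero] at hR h ⊢
      intro k hk
      rw [coeff_sub, coeff_C_mul, hR k hk, h k hk, mul_zero, sub_zero]
    · have hlt : (P k).degree < (m + 1 : ℕ) :=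
        (hP.degree_lt k).trans_le (by exact_mod_cast hk)
      have h1 : (1 : Matrix (Fin N ⊕ Fin N) (Fin N ⊕ Fin N) ℂ).submatrix Sum.inr Sum.inr
          = (1 : Matrix (Fin N) (Fin N) ℂ) := by
        ext i j
        simp [Matrix.one_apply]
      rw [hW.innerW_sub_left, hY.innerW_row hW hab Sum.inr hS rfl hlt, h1, one_mul,
        hW.innerW_C_mul_left, smul_mul_assoc]
      rcases (Nat.lt_succ_iff.1 hk).eq_or_lt with rfl | hkm
      · rw [hκ.gam_mul_innerW hW, (hP k).2.1, conjTranspose_one, sub_self]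
      · have hlt' : (P k).degree < (m : ℕ) := (hP.degree_lt k).trans_le (by exact_mod_cast hkm)
        rw [hP.orth hlt', (degree_lt_iff_coeff_zero _ _).1 hlt' m le_rfl, conjTranspose_zero,
          mul_zero, sub_self]
  intro w hw i j
  rw [hS w hw, sub_eq_zero.1 h0]

theorem IsRHSolution.eq_upper (hY : IsRHSolution a b ga gb W n Y)
    (hP : IsMonicOrthogonal a b W P) (hκ : IsNormalizedBy a b W P κ)
    (hW : IsWeight a b ga gb W) (hab : a < b) {z : ℂ} (hz : z ∈ offInt a b) :
    (Y z).toBlocks₁₁ = val (P n) z ∧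
      (Y z).toBlocks₁₂ = (2 * Real.pi * Complex.I)⁻¹ • kern a b W 1 (P n) 1 z := by
  have h := hY.eq_left_upper hP hκ hW hab
  constructor <;> ext i j
  · exact h z hz i j
  · exact hY.cauchy_row hW hab Sum.inl h (Or.inr (by simp)) hz i j

theorem IsRHSolution.eq_fromBlocks_succ {m : ℕ} (hY : IsRHSolution a b ga gb W (m + 1) Y)
    (hP : IsMonicOrthogonal a b W P) (hκ : IsNormalizedBy a b W P κ)
    (hW : IsWeight a b ga gb W) (hab : a < b) {z : ℂ} (hz : z ∈ offInt a b) :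
    Y z = fromBlocks (val (P (m + 1)) z)
      ((2 * Real.pi * Complex.I)⁻¹ • kern a b W 1 (P (m + 1)) 1 z)
      ((-(2 * Real.pi * Complex.I)) • (gam κ m * val (P m) z))
      ((-1 : ℂ) • (gam κ m * kern a b W 1 (P m) 1 z)) := by
  obtain ⟨h1, h2⟩ := hY.eq_upper hP hκ hW hab hz
  have h := hY.eq_left_lower hP hκ hW hab
  rw [← fromBlocks_toBlocks (Y z), h1, h2, fromBlocks_inj]
  refine ⟨rfl, rfl, ?_, ?_⟩ <;> ext i j
  · rw [toBlocks₂₁, of_apply, h z hz, val_C_mul, smul_mul_assoc]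
  · rw [toBlocks₂₂, of_apply, hY.cauchy_row hW hab Sum.inr h (Or.inl (Nat.succ_pos m)) hz i j,
      kern_C_mul_left hW _ _ _ hz, smul_mul_assoc, Matrix.smul_apply, Matrix.smul_apply,
      smul_eq_mul, smul_eq_mul, ← mul_assoc, mul_neg, inv_mul_cancel₀ Complex.two_pi_I_ne_zero]

/-- The lower left block is a polynomial of degree below `0`. The lower right one therefore has no
jump, and minus the identity it decays, so it is the identity. -/
theorem IsRHSolution.eq_fromBlocks_zero (hY : IsRHSolution a b ga gb W 0 Y)
    (hP : IsMonicOrthogonal a b W P) (hκ : IsNormalizedBy a b W P κ)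
    (hW : IsWeight a b ga gb W) (hab : a < b) {z : ℂ} (hz : z ∈ offInt a b) :
    Y z = fromBlocks (val (P 0) z) ((2 * Real.pi * Complex.I)⁻¹ • kern a b W 1 (P 0) 1 z) 0 1 := by
  obtain ⟨h1, h2⟩ := hY.eq_upper hP hκ hW hab hz
  obtain ⟨R, hR, hRe⟩ := hY.exists_left hab Sum.inr
  have hR0 : R = 0 := by
    ext1 m
    exact (degree_lt_iff_coeff_zero _ _).1 hR m (Nat.zero_le _)
  have hS : ∀ w ∈ offInt a b, ∀ i j, Y w (Sum.inr i) (Sum.inl j) =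
      val (0 : (Matrix (Fin N) (Fin N) ℂ)[X]) w i j := by
    intro w hw i j
    rw [hRe w hw i j, hR0]
    simp
  rw [← fromBlocks_toBlocks (Y z), h1, h2, fromBlocks_inj]
  refine ⟨rfl, rfl, ?_, ?_⟩ <;> ext i j
  · rw [toBlocks₂₁, of_apply, hS z hz, val_zero]
  · have hcut := (hY.cut_right hW hab Sum.inr hS i j).pow_mul_sub hab.le 0
      ((1 : Matrix (Fin N ⊕ Fin N) (Fin N ⊕ Fin N) ℂ) (Sum.inr i) (Sum.inr j))
    have h3 := hcut.eq_cauchy hab.le (by simp [val_zero]) (hY.infinity_right (Sum.inr i) j) hz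
    simp only [val_zero, zero_mul, Matrix.zero_apply, mul_zero, integral_zero, pow_zero,
      one_mul] at h3
    have h4 := (mul_eq_zero.1 h3).resolve_left Complex.two_pi_I_ne_zero
    rw [toBlocks₂₂, of_apply, sub_eq_zero.1 h4]
    simp [Matrix.one_apply]

theorem MatDeriv.fromBlocks {A B C D : ℂ → Matrix (Fin N) (Fin N) ℂ}
    {A' B' C' D' : Matrix (Fin N) (Fin N) ℂ} {z : ℂ} (hA : MatDeriv A A' z)
    (hB : MatDeriv B B' z) (hC : MatDeriv C C' z) (hD : MatDeriv D D' z) :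
    MatDeriv (fun w => Matrix.fromBlocks (A w) (B w) (C w) (D w))
      (Matrix.fromBlocks A' B' C' D') z := by
  rintro (i | i) (j | j)
  exacts [hA i j, hB i j, hC i j, hD i j]

theorem MatDeriv.const_smul {F : ℂ → Matrix (Fin N) (Fin N) ℂ}
    {F' : Matrix (Fin N) (Fin N) ℂ} {z : ℂ} (c : ℂ) (hF : MatDeriv F F' z) :
    MatDeriv (fun w => c • F w) (c • F') z := fun i j => (hF i j).const_mul c

theorem MatDeriv.const_mul {F : ℂ → Matrix (Fin N) (Fin N) ℂ}
    {F' : Matrix (Fin N) (Fin N) ℂ} {z : ℂ} (A : Matrix (Fin N) (Fin N) ℂ)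
    (hF : MatDeriv F F' z) : MatDeriv (fun w => A * F w) (A * F') z := by
  simpa using (MatDeriv.const A).mul hF

theorem MatDeriv.congr_offInt {l m : Type*} {F G : ℂ → Matrix l m ℂ} {F' : Matrix l m ℂ} {z : ℂ}
    (hF : MatDeriv F F' z) (hz : z ∈ offInt a b) (h : ∀ w ∈ offInt a b, G w = F w) :
    MatDeriv G F' z := fun i j => (hF i j).congr_of_eventuallyEq <| by
  filter_upwards [(isOpen_offInt a b).mem_nhds hz] with w hw
  rw [h w hw]

theorem gam_conjTranspose (κ : ℕ → Matrix (Fin N) (Fin N) ℂ) (n : ℕ) : (gam κ n)ᴴ = gam κ n := by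
  rw [gam, conjTranspose_mul, conjTranspose_conjTranspose]

theorem inv_gam_mul_frakA (hκ : IsNormalizedBy a b W P κ) (hW : IsWeight a b ga gb W) (z : ℂ) :
    (gam κ n)⁻¹ * frakA a b W (P n) (gam κ n) z = -cauchyTerm a b W (P n) (P n) z := by
  have h := hκ.gam_mul_innerW hW n
  rw [frakA, mul_neg, ← mul_assoc, Matrix.inv_eq_right_inv h, mul_eq_one_comm.1 h, one_mul]

/-- The rows use the linear system with `r = m + 1` and `r = m`. The second needs the term with `P
m` on the left of `P (m + 1)`. By conjugation it is the adjoint of the mixed term at `conj z`, which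
is how `𝔅_n^*` enters. -/
theorem IsRHSolution.matDeriv_succ {m : ℕ} (hY : IsRHSolution a b ga gb W (m + 1) Y)
    (hP : IsMonicOrthogonal a b W P) (hκ : IsNormalizedBy a b W P κ)
    (hW : IsWeight a b ga gb W) (hab : a < b) {z : ℂ} (hz : z ∈ offInt a b)
    (hpp : TermExists a b W (P (m + 1)) (P (m + 1)) z) (hqq : TermExists a b W (P m) (P m) z)
    (hpq : TermExists a b W (P (m + 1)) (P m) z)
    (hpq' : TermExists a b W (P (m + 1)) (P m) ((starRingEnd ℂ) z)) :
    MatDeriv Y (coeffF a b W P κ (m + 1) z * Y z) z := by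
  obtain ⟨hqp, hqp'⟩ := hW.termExists_conj hab hpq'
  obtain ⟨p1, p2⟩ := linear_system hP hκ hW hab m (m + 1) (Or.inr rfl) hz hpq hpp
  obtain ⟨q1, q2⟩ := linear_system hP hκ hW hab m m (Or.inl rfl) hz hqq hqp
  have hexp := MatDeriv.fromBlocks (matDeriv_val (P (m + 1)) z)
    ((hW.matDeriv_kern (P (m + 1)) hz).const_smul (2 * Real.pi * Complex.I)⁻¹)
    (((matDeriv_val (P m) z).const_mul (gam κ m)).const_smul (-(2 * Real.pi * Complex.I)))
    (((hW.matDeriv_kern (P m) hz).const_mul (gam κ m)).const_smul (-1))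
  have hd := hexp.congr_offInt hz fun w hw => hY.eq_fromBlocks_succ hP hκ hW hab hw
  convert hd using 1
  rw [hY.eq_fromBlocks_succ hP hκ hW hab hz, coeffF, inv_gam_mul_frakA hκ hW, conjStar]
  simp only [prev]
  rw [frakB, frakB, conjTranspose_neg, conjTranspose_mul, gam_conjTranspose, ← hqp', frakA,
    fromBlocks_multiply, fromBlocks_inj, p1, p2, q1, q2]
  have hI := Complex.two_pi_I_ne_zero
  set c : ℂ := 2 * Real.pi * Complex.I
  rw [one_div]
  refine ⟨?_, ?_, ?_, ?_⟩ <;>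
  simp only [neg_mul, mul_neg, neg_neg, smul_neg, neg_smul, smul_mul_assoc, mul_smul_comm,
    smul_smul, mul_inv_cancel₀ hI, inv_mul_cancel₀ hI, one_smul, mul_sub, smul_sub,
    mul_assoc] <;> abel

/-- With `P 0 = 1` and all terms of index `-1` zero, only the upper right entry varies, and its
derivative is the single surviving coefficient. -/
theorem IsRHSolution.matDeriv_zero (hY : IsRHSolution a b ga gb W 0 Y)
    (hP : IsMonicOrthogonal a b W P) (hκ : IsNormalizedBy a b W P κ)
    (hW : IsWeight a b ga gb W) (hab : a < b) {z : ℂ} (hz : z ∈ offInt a b)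
    (hpp : TermExists a b W (P 0) (P 0) z) :
    MatDeriv Y (coeffF a b W P κ 0 z * Y z) z := by
  have hP0 : P 0 = 1 := by
    ext1 m
    rcases Nat.eq_zero_or_pos m with rfl | hm
    · rw [(hP 0).2.1, coeff_one_zero]
    · rw [(degree_lt_iff_coeff_zero _ _).1 (hP.degree_lt 0) m (by omega), coeff_one, if_neg hm.ne']
  have hexp := MatDeriv.fromBlocks (matDeriv_val (P 0) z)
    ((hW.matDeriv_kern (P 0) hz).const_smul (2 * Real.pi * Complex.I)⁻¹)
    (MatDeriv.const (t := z) 0) (MatDeriv.const (t := z) 1)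
  have hd := hexp.congr_offInt hz fun w hw => hY.eq_fromBlocks_zero hP hκ hW hab hw
  convert hd using 1
  have hT := hW.cauchyTerm_eq_of_orth hab hP (Nat.le_succ 0) (Nat.le_succ 0) hz hpp
  rw [hY.eq_fromBlocks_zero hP hκ hW hab hz, coeffF, inv_gam_mul_frakA hκ hW, conjStar, hT]
  simp [prev, frakB, fromBlocks_multiply, hP0, val_one, val_zero]

end solution

end MOPRL

theorem mainTheorem6 {N : ℕ} (a b : EReal) (hab : a < b) (ga gb : ℝ)
    (W : ℝ → Matrix (Fin N) (Fin N) ℝ) (hW : MOPRL.IsWeight a b ga gb W)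
    (P : ℕ → Polynomial (Matrix (Fin N) (Fin N) ℂ)) (hP : MOPRL.IsMonicOrthogonal a b W P)
    (κ : ℕ → Matrix (Fin N) (Fin N) ℂ) (hκ : MOPRL.IsNormalizedBy a b W P κ) (n : ℕ) :
    -- the differential equation for the solution of the Riemann-Hilbert problem
    ((∀ z ∈ MOPRL.offInt a b,
        MOPRL.TermExists a b W (P n) (P n) z ∧
        MOPRL.TermExists a b W (MOPRL.prev P n) (MOPRL.prev P n) z ∧
        MOPRL.TermExists a b W (P n) (MOPRL.prev P n) z) →
      ∀ Y : ℂ → Matrix (Fin N ⊕ Fin N) (Fin N ⊕ Fin N) ℂ,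
        MOPRL.IsRHSolution a b ga gb W n Y →
        ∀ z ∈ MOPRL.offInt a b, ∀ i j,
          HasDerivAt (fun w => Y w i j) ((MOPRL.coeffF a b W P κ n z * Y z) i j) z) ∧
    -- the symmetry relation
    ((∀ z ∈ MOPRL.offInt a b, MOPRL.TermExists a b W (P n) (P n) z) →
      ∀ z ∈ MOPRL.offInt a b,
        MOPRL.gam κ n * MOPRL.conjStar (MOPRL.frakA a b W (P n) (MOPRL.gam κ n)) z =
          MOPRL.frakA a b W (P n) (MOPRL.gam κ n) z * MOPRL.gam κ n) := by
  refine ⟨fun hT Y hY z hz => ?_, fun hT z hz => ?_⟩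
  · cases n with
    | zero => exact hY.matDeriv_zero hP hκ hW hab hz (hT z hz).1
    | succ m =>
      exact hY.matDeriv_succ hP hκ hW hab hz (hT z hz).1 (hT z hz).2.1 (hT z hz).2.2
        (hT _ (MOPRL.conj_mem_offInt hz)).2.2
  · have h := (hW.termExists_conj hab (hT _ (MOPRL.conj_mem_offInt hz))).2
    -- With `T` the Cauchy term, both sides equal `-γ T(z) γ`, because `T(conj z)^* = T(z)` and `γ^*
    -- = γ`.
    rw [MOPRL.conjStar, MOPRL.frakA, MOPRL.frakA, conjTranspose_neg, conjTranspose_mul, ← h,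
      MOPRL.gam_conjTranspose, mul_neg, neg_mul, mul_assoc]
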